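/- Consider $K$ single-antenna users, $M$ single-antenna access points (APs) and a satellite with $N$ receive antennas. The satellite channel of user $k$ is $\mathbf g_k\sim\mathcal{CN}(\bar{\mathbf g}_k,\mathbf R_k)$, with $\bar{\mathbf g}_k\in\mathbb C^N$ and $\mathbf R_k\in\mathbb C^{N\times N}$ positive semidefinite, and the channel from user $k$ to AP $m$ is $g_{mk}\sim\mathcal{CN}(0,\beta_{mk})$, $\beta_{mk}\ge 0$. Let $\pmb\phi_1,\dots,\pmb\phi_K\in\mathbb C^K$ be orthonormal pilots and $p\ge 0$ the pilot power. The received pilot signals are $$\mathbf y_{pm}^H=\sum_{k=1}^K\sqrt{pK}\,g_{mk}\pmb\phi_k^H+\mathbf w_{pm}^H,\qquad \mathbf Y_p=\sum_{k=1}^K\sqrt{pK}\,\mathbf g_k\pmb\phi_k^H+\mathbf W_p,$$ where $\mathbf w_{pm}\sim\mathcal{CN}(\mathbf 0,\sigma_a^2\mathbf I_K)$ and $\mathbf W_p\in\mathbb C^{N\times K}$ has independent $\mathcal{CN}(0,\sigma_s^2)$ entries. The data-phase noises are $\mathbf w\sim\mathcal{CN}(\mathbf 0,\sigma_s^2\mathbf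 I_N)$ at the satellite and $w_m\sim\mathcal{CN}(0,\sigma_a^2)$ at AP $m$, with $\sigma_s,\sigma_a>0$. All channels and noises ($\mathbf g_k$, $g_{mk}$, $\mathbf W_p$, $\mathbf w_{pm}$, $\mathbf w$, $w_m$ for all $m,k$) are mutually independent. The MMSE channel estimates are $\hat g_{mk}=\mathbb E\{g_{mk}\mid\mathbf y_{pm}^H\pmb\phi_k\}$ and $\hat{\mathbf g}_k=\mathbb E\{\mathbf g_k\mid\mathbf Y_p\pmb\phi_k\}$. User $k$ has data power $\rho_k\ge 0$. For detection vectors $\mathbf u_k$ (satellite) and coefficients $u_{mk}$ (APs) put $z_{kk'}=\mathbf u_k^H\mathbf g_{k'}+\sum_{m=1}^M u_{mk}^*g_{mk'}$. The use-and-then-forget effective uplink SINR of user $k$ is $$\mathrm{SINR}_k=\frac{\rho_k|\mathbb E\{z_{kk}\}|^2}{\sum_{k'=1}^K\rho_{k'}\mathbb E\{|z_{kk'}|^2\}-\rho_k|\mathbb E\{z_{kk}\}|^2+\mathbb E\{|\mathbf u_k^H\mathbf w|^2\}+\sum_{m=1}^M\mathbb E\{|u_{mk}^*w_m|^2\}},$$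 and its net throughput is $R_k=(1-K/\tau_c)\,B\log_2(1+\mathrm{SINR}_k)$, with bandwidth $B>0$ and $\tau_c>K$ subcarriers per OFDM symbol. Suppose maximum ratio combining is used, that is, $\mathbf u_k=\hat{\mathbf g}_k$ and $u_{mk}=\hat g_{mk}$ for all $m,k$. Let $$\gamma_{mk}=\frac{pK\beta_{mk}^2}{pK\beta_{mk}+\sigma_a^2},\qquad \pmb\Theta_k=\mathbf R_k\left(pK\mathbf R_k+\sigma_s^2\mathbf I_N\right)^{-1}\mathbf R_k .$$ Then, for every user $k$, all expectations in $\mathrm{SINR}_k$ exist and are finite, $$\mathrm{SINR}_k=\frac{\rho_k\left(\|\bar{\mathbf g}_k\|^2+pK\,\mathrm{tr}(\pmb\Theta_k)+\sum_{m=1}^M\gamma_{mk}\right)^2}{\mathsf{MI}_k+\mathsf{NO}_k},$$ and $R_k$ is given by the formula above with this value of $\mathrm{SINR}_k$, where $$\begin{aligned}\mathsf{MI}_k={}&\sum_{k'\ne k}\rho_{k'}|\bar{\mathbf g}_k^H\bar{\mathbf g}_{k'}|^2+pK\sum_{k'=1}^K\rho_{k'}\bar{\mathbf g}_{k'}^H\pmb\Theta_k\bar{\mathbf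 g}_{k'}+\sum_{k'=1}^K\rho_{k'}\bar{\mathbf g}_k^H\mathbf R_{k'}\bar{\mathbf g}_k\\&+pK\sum_{k'=1}^K\rho_{k'}\mathrm{tr}(\mathbf R_{k'}\pmb\Theta_k)+\sum_{k'=1}^K\sum_{m=1}^M\rho_{k'}\gamma_{mk}\beta_{mk'},\\ \mathsf{NO}_k={}&\sigma_s^2\|\bar{\mathbf g}_k\|^2+pK\sigma_s^2\,\mathrm{tr}(\pmb\Theta_k)+\sigma_a^2\sum_{m=1}^M\gamma_{mk}.\end{aligned}$$ (In the degenerate case where the estimates of user $k$ vanish almost surely, both denominators are $0$ and both quotients are read as $0$.) -/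

import Mathlib

open MeasureTheory ProbabilityTheory

open scoped ComplexConjugate ComplexOrder

noncomputable section

namespace SpaceTerrestrial

/-- The real number `xᴴ A x` (the real part is taken only to obtain a real number; for the
Hermitian matrices used below the form is real). -/
def quadForm {n : ℕ} (A : Matrix (Fin n) (Fin n) ℂ) (x : EuclideanSpace ℂ (Fin n)) : ℝ :=
  (star x.ofLp ⬝ᵥ A.mulVec x.ofLp).re

/-- The random vector `X` has the circularly symmetric complex Gaussian distribution
`CN(μ, R)` (possibly degenerate): every real linear functional `Re (tᴴ X)` is a real Gaussian
with mean `Re (tᴴ μ)` and variance `tᴴ R t / 2`. -/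
structure IsCN {Ω : Type*} [MeasurableSpace Ω] (P : Measure Ω) {ι : Type*} [Fintype ι]
    (X : Ω → EuclideanSpace ℂ ι) (μ : EuclideanSpace ℂ ι) (R : Matrix ι ι ℂ) : Prop where
  measurable : Measurable X
  map_re_inner : ∀ t : EuclideanSpace ℂ ι,
    P.map (fun ω => (inner ℂ t (X ω)).re) =
      gaussianReal (inner ℂ t μ).re
        ((star t.ofLp ⬝ᵥ R.mulVec t.ofLp).re / 2).toNNReal

/-- The complex random variable `X` has the circularly symmetric complex Gaussian distribution
`CN(μ, v)`. -/
structure IsScalarCN {Ω : Type*} [MeasurableSpace Ω] (P : Measure Ω)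
    (X : Ω → ℂ) (μ : ℂ) (v : ℝ) : Prop where
  measurable : Measurable X
  map_re_mul : ∀ t : ℂ,
    P.map (fun ω => (conj t * X ω).re) =
      gaussianReal (conj t * μ).re (‖t‖ ^ 2 * v / 2).toNNReal

/-- Deterministic parameters of a network with `K` users, `M` access points (APs) and a satellite
with `N` receive antennas. -/
structure Setup (K M N : ℕ) where
  /-- power of each pilot symbol -/
  p : ℝ
  p_nonneg : 0 ≤ p
  /-- data powers of the users -/
  ρ : Fin K → ℝ
  ρ_nonneg : ∀ k, 0 ≤ ρ k
  /-- noise standard deviation at the satellite -/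
  σs : ℝ
  σs_pos : 0 < σs
  /-- noise standard deviation at the APs -/
  σa : ℝ
  σa_pos : 0 < σa
  /-- large-scale fading coefficients between the APs and the users -/
  β : Fin M → Fin K → ℝ
  β_nonneg : ∀ m k, 0 ≤ β m k
  /-- line-of-sight components of the satellite channels -/
  gbar : Fin K → EuclideanSpace ℂ (Fin N)
  /-- covariance matrices of the satellite channels -/
  R : Fin K → Matrix (Fin N) (Fin N) ℂ
  R_posSemidef : ∀ k, (R k).PosSemidef
  /-- pilot sequences -/
  φ : Fin K → EuclideanSpace ℂ (Fin K)
  φ_orthonormal : Orthonormal ℂ φ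

/-- The random quantities: channels, pilot-phase noises and data-phase noises. -/
structure Signals (Ω : Type*) (K M N : ℕ) where
  /-- satellite channel of each user -/
  g : Fin K → Ω → EuclideanSpace ℂ (Fin N)
  /-- channel between AP `m` and user `k` -/
  gAP : Fin M → Fin K → Ω → ℂ
  /-- pilot-phase noise matrix (`N × K`) at the satellite gateway -/
  Wp : Ω → EuclideanSpace ℂ (Fin N × Fin K)
  /-- pilot-phase noise vector at AP `m` -/
  wp : Fin M → Ω → EuclideanSpace ℂ (Fin K)
  /-- data-phase noise at the satellite -/
  w : Ω → EuclideanSpace ℂ (Fin N)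
  /-- data-phase noise at AP `m` -/
  wAP : Fin M → Ω → ℂ

/-- Labels of the independent sources of randomness. -/
inductive Source (K M : ℕ) : Type
  | satChannel (k : Fin K) : Source K M
  | apChannel (m : Fin M) (k : Fin K) : Source K M
  | satPilotNoise : Source K M
  | apPilotNoise (m : Fin M) : Source K M
  | satNoise : Source K M
  | apNoise (m : Fin M) : Source K M

variable {Ω : Type*} {K M N : ℕ}

/-- The σ-algebra generated by one source of randomness. -/
@[reducible]
def Signals.sigma (X : Signals Ω K M N) : Source K M → MeasurableSpace Ω
  | .satChannel k => MeasurableSpace.comap (X.g k) inferInstance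
  | .apChannel m k => MeasurableSpace.comap (X.gAP m k) inferInstance
  | .satPilotNoise => MeasurableSpace.comap X.Wp inferInstance
  | .apPilotNoise m => MeasurableSpace.comap (X.wp m) inferInstance
  | .satNoise => MeasurableSpace.comap X.w inferInstance
  | .apNoise m => MeasurableSpace.comap (X.wAP m) inferInstance

/-- The channel and noise model: correlated Rician satellite channels, Rayleigh AP channels,
white Gaussian noises, all mutually independent. -/
structure Signals.HasModel [MeasurableSpace Ω] (X : Signals Ω K M N) (P : Measure Ω)
    (S : Setup K M N) : Prop where
  g_law : ∀ k, IsCN P (X.g k) (S.gbar k) (S.R k)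
  gAP_law : ∀ m k, IsScalarCN P (X.gAP m k) 0 (S.β m k)
  Wp_law : IsCN P X.Wp 0 (((S.σs ^ 2 : ℝ) : ℂ) • 1)
  wp_law : ∀ m, IsCN P (X.wp m) 0 (((S.σa ^ 2 : ℝ) : ℂ) • 1)
  w_law : IsCN P X.w 0 (((S.σs ^ 2 : ℝ) : ℂ) • 1)
  wAP_law : ∀ m, IsScalarCN P (X.wAP m) 0 (S.σa ^ 2)
  indep : iIndep X.sigma P

/-- The pilot signal `y_pm` received at AP `m`, that is,
`y_pmᴴ = ∑ₖ √(pK) g_mk φₖᴴ + w_pmᴴ`. -/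
def apPilot (S : Setup K M N) (X : Signals Ω K M N) (m : Fin M) (ω : Ω) :
    EuclideanSpace ℂ (Fin K) :=
  ∑ k, ((Real.sqrt (S.p * K) : ℂ) * conj (X.gAP m k ω)) • S.φ k + X.wp m ω

/-- The pilot signal `Y_p = ∑ₖ √(pK) gₖ φₖᴴ + W_p` received at the satellite gateway. -/
def satPilot (S : Setup K M N) (X : Signals Ω K M N) (ω : Ω) : Matrix (Fin N) (Fin K) ℂ :=
  ∑ k, (Real.sqrt (S.p * K) : ℂ) • Matrix.vecMulVec (X.g k ω).ofLp (star (S.φ k).ofLp)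
    + Matrix.of (fun n j => X.Wp ω (n, j))

/-- The despread AP observation `y_pmᴴ φₖ`. -/
def apObs (S : Setup K M N) (X : Signals Ω K M N) (m : Fin M) (k : Fin K) (ω : Ω) : ℂ :=
  inner ℂ (apPilot S X m ω) (S.φ k)

/-- The despread satellite observation `Y_p φₖ`. -/
def satObs (S : Setup K M N) (X : Signals Ω K M N) (k : Fin K) (ω : Ω) :
    EuclideanSpace ℂ (Fin N) :=
  WithLp.toLp 2 ((satPilot S X ω).mulVec (S.φ k).ofLp)

/-- The MMSE estimate `E{g_mk | y_pmᴴ φₖ}` of the AP channel. -/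
def apEstimate [MeasurableSpace Ω] (P : Measure Ω) (S : Setup K M N) (X : Signals Ω K M N)
    (m : Fin M) (k : Fin K) : Ω → ℂ :=
  P[X.gAP m k | MeasurableSpace.comap (apObs S X m k) inferInstance]

/-- The MMSE estimate `E{gₖ | Y_p φₖ}` of the satellite channel. -/
def satEstimate [MeasurableSpace Ω] (P : Measure Ω) (S : Setup K M N) (X : Signals Ω K M N)
    (k : Fin K) : Ω → EuclideanSpace ℂ (Fin N) :=
  P[X.g k | MeasurableSpace.comap (satObs S X k) inferInstance]

/-- The overall channel coefficient `z_{kk'} = uₖᴴ g_{k'} + ∑ₘ u_mk^* g_{mk'}` for detection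
vectors `u k` at the satellite and detection coefficients `uAP m k` at the APs. -/
def overallCoeff (X : Signals Ω K M N) (u : Fin K → Ω → EuclideanSpace ℂ (Fin N))
    (uAP : Fin M → Fin K → Ω → ℂ) (k k' : Fin K) (ω : Ω) : ℂ :=
  inner ℂ (u k ω) (X.g k' ω) + ∑ m, conj (uAP m k ω) * X.gAP m k' ω

/-- The use-and-then-forget effective uplink SINR of user `k` for arbitrary linear detectors. -/
def sinr [MeasurableSpace Ω] (P : Measure Ω) (S : Setup K M N) (X : Signals Ω K M N)
    (u : Fin K → Ω → EuclideanSpace ℂ (Fin N)) (uAP : Fin M → Fin K → Ω → ℂ) (k : Fin K) : ℝ :=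
  S.ρ k * ‖∫ ω, overallCoeff X u uAP k k ω ∂P‖ ^ 2 /
    (∑ k', S.ρ k' * ∫ ω, ‖overallCoeff X u uAP k k' ω‖ ^ 2 ∂P
      - S.ρ k * ‖∫ ω, overallCoeff X u uAP k k ω ∂P‖ ^ 2
      + ∫ ω, ‖inner ℂ (u k ω) (X.w ω)‖ ^ 2 ∂P
      + ∑ m, ∫ ω, ‖conj (uAP m k ω) * X.wAP m ω‖ ^ 2 ∂P)

/-- All expectations that occur in the SINR of user `k` exist. -/
structure FiniteMoments [MeasurableSpace Ω] (P : Measure Ω) (X : Signals Ω K M N)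
    (u : Fin K → Ω → EuclideanSpace ℂ (Fin N)) (uAP : Fin M → Fin K → Ω → ℂ) (k : Fin K) :
    Prop where
  coeff : Integrable (overallCoeff X u uAP k k) P
  coeff_sq : ∀ k', Integrable (fun ω => ‖overallCoeff X u uAP k k' ω‖ ^ 2) P
  satNoise_sq : Integrable (fun ω => ‖inner ℂ (u k ω) (X.w ω)‖ ^ 2) P
  apNoise_sq : ∀ m, Integrable (fun ω => ‖conj (uAP m k ω) * X.wAP m ω‖ ^ 2) P

/-- The net throughput `(1 - K/τ_c) B log₂(1 + SINR)`. -/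
def throughput (K τc : ℕ) (B sinrValue : ℝ) : ℝ :=
  (1 - (K : ℝ) / (τc : ℝ)) * B * Real.logb 2 (1 + sinrValue)

namespace Setup

variable (S : Setup K M N)

/-- `γ_mk = pK β_mk² / (pK β_mk + σ_a²)`. -/
def γ (m : Fin M) (k : Fin K) : ℝ :=
  S.p * K * S.β m k ^ 2 / (S.p * K * S.β m k + S.σa ^ 2)

/-- `Φₖ = (pK Rₖ + σ_s² I)⁻¹`. -/
def Φ (k : Fin K) : Matrix (Fin N) (Fin N) ℂ :=
  (((S.p * K : ℝ) : ℂ) • S.R k + ((S.σs ^ 2 : ℝ) : ℂ) • (1 : Matrix (Fin N) (Fin N) ℂ))⁻¹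

/-- `Θₖ = Rₖ Φₖ Rₖ`. -/
def Θ (k : Fin K) : Matrix (Fin N) (Fin N) ℂ := S.R k * S.Φ k * S.R k

/-- The closed-form mutual interference. -/
def MI (k : Fin K) : ℝ :=
  ∑ k' ∈ Finset.univ.erase k, S.ρ k' * ‖inner ℂ (S.gbar k) (S.gbar k')‖ ^ 2
  + S.p * K * ∑ k', S.ρ k' * quadForm (S.Θ k) (S.gbar k')
  + ∑ k', S.ρ k' * quadForm (S.R k') (S.gbar k)
  + S.p * K * ∑ k', S.ρ k' * (S.R k' * S.Θ k).trace.re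
  + ∑ k', ∑ m, S.ρ k' * S.γ m k * S.β m k'

/-- The closed-form noise power. -/
def NO (k : Fin K) : ℝ :=
  S.σs ^ 2 * ‖S.gbar k‖ ^ 2 + S.p * K * S.σs ^ 2 * (S.Θ k).trace.re
  + S.σa ^ 2 * ∑ m, S.γ m k

/-- The closed-form SINR. -/
def closedSINR (k : Fin K) : ℝ :=
  S.ρ k * (‖S.gbar k‖ ^ 2 + S.p * K * (S.Θ k).trace.re + ∑ m, S.γ m k) ^ 2 /
    (S.MI k + S.NO k)

end Setup

end SpaceTerrestrial

end

/-! Orthonormality of the pilots removes every other user from a despread observation, which becomes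
`y = a g + n` with `a = √(pK)` and white Gaussian noise `n` independent of `g` (`satObs_eq`,
`apObs_eq`). For such a Gaussian pair the affine estimator with gain `A = a R Q⁻¹`, `Q = a² R + σ²
I`, has an error uncorrelated with `y`, hence independent of it (`IsCN.indepFun_mulVecE`). It is
therefore the conditional expectation, and `g = ĝ + e` with independent `ĝ ~ CN(μ, C)` and `e ~
CN(0, R - C)`, where `C = a² R Q⁻¹ R` is `pK Θ` at the satellite and `γ` at an AP
(`exists_mmse_estimator`).

For fixed `k, k'` the satellite and AP contributions to `z_{kk'}` come from disjoint sources, so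
their variances add (`integral_norm_sum_sq_of_pairwise_indepFun`). At the satellite, `ĝₖ` is
independent of `g_{k'}` when `k' ≠ k`, and second moments suffice. When `k' = k`, the decomposition
`gₖ = ĝₖ + e` and the Gaussian fourth moment `E‖ĝ‖⁴ = (‖μ‖² + tr C)² + tr C² + 2 μᴴCμ` are needed.
In both cases the variance is `μ_{k'}ᴴ C μ_{k'} + μₖᴴ R_{k'} μₖ + tr(R_{k'} C)`. This is why all
sums in `MI` but the first run over every `k'`: only the squared mean distinguishes `k' = k`, and
there it cancels against the subtracted `ρₖ |E z_{kk}|²`. An AP is the same computation in dimension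
one with mean zero.

Since `IsCN` describes only real functionals `Re(tᴴX)`, all moments are reduced to those of real
Gaussians by polarization and summation over the real basis `e_j, i e_j`. -/

namespace SpaceTerrestrial

/-- The sesquilinear form `sᴴ R t`. -/
noncomputable def sesqForm {ι κ : Type*} [Fintype ι] [Fintype κ] (R : Matrix ι κ ℂ)
    (s : EuclideanSpace ℂ ι) (t : EuclideanSpace ℂ κ) : ℂ :=
  star s.ofLp ⬝ᵥ R.mulVec t.ofLp

/-! ### Sesquilinear forms and matrix-vector products. -/

section SesqForm

variable {ι κ : Type*} [Fintype ι] [Fintype κ]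

lemma sesqForm_add_left (R : Matrix ι ι ℂ) (s s' t : EuclideanSpace ℂ ι) :
    sesqForm R (s + s') t = sesqForm R s t + sesqForm R s' t := by
  simp [sesqForm, add_dotProduct]

lemma sesqForm_add_right (R : Matrix ι ι ℂ) (s t t' : EuclideanSpace ℂ ι) :
    sesqForm R s (t + t') = sesqForm R s t + sesqForm R s t' := by
  simp [sesqForm, Matrix.mulVec_add]

lemma sesqForm_sub_left (R : Matrix ι ι ℂ) (s s' t : EuclideanSpace ℂ ι) :
    sesqForm R (s - s') t = sesqForm R s t - sesqForm R s' t := by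
  simp [sesqForm, sub_dotProduct]

lemma sesqForm_sub_right (R : Matrix ι ι ℂ) (s t t' : EuclideanSpace ℂ ι) :
    sesqForm R s (t - t') = sesqForm R s t - sesqForm R s t' := by
  simp [sesqForm, Matrix.mulVec_sub]

lemma sesqForm_smul_left (R : Matrix ι ι ℂ) (c : ℂ) (s t : EuclideanSpace ℂ ι) :
    sesqForm R (c • s) t = conj c * sesqForm R s t := by
  simp [sesqForm]

lemma sesqForm_smul_right (R : Matrix ι ι ℂ) (c : ℂ) (s t : EuclideanSpace ℂ ι) :
    sesqForm R s (c • t) = c * sesqForm R s t := by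
  simp [sesqForm, Matrix.mulVec_smul]

lemma sesqForm_swap {R : Matrix ι ι ℂ} (hR : R.IsHermitian) (s t : EuclideanSpace ℂ ι) :
    sesqForm R t s = conj (sesqForm R s t) := by
  rw [sesqForm, sesqForm, starRingEnd_apply, Matrix.star_dotProduct, Matrix.star_mulVec, hR.eq,
    ← Matrix.dotProduct_mulVec]

lemma sesqForm_single [DecidableEq ι] (R : Matrix ι ι ℂ) (i j : ι) :
    sesqForm R (EuclideanSpace.single i 1) (EuclideanSpace.single j 1) = R i j := by
  simp [sesqForm]

lemma sesqForm_self_nonneg {R : Matrix ι ι ℂ} (hR : R.PosSemidef) (t : EuclideanSpace ℂ ι) :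
    0 ≤ (sesqForm R t t).re :=
  (Complex.le_def.1 (hR.dotProduct_mulVec_nonneg t.ofLp)).1

/-- The matrix-vector product on Euclidean space. -/
noncomputable def mulVecE (A : Matrix κ ι ℂ) (x : EuclideanSpace ℂ ι) : EuclideanSpace ℂ κ :=
  WithLp.toLp 2 (A.mulVec x.ofLp)

lemma inner_mulVecE (A : Matrix κ ι ℂ) (t : EuclideanSpace ℂ κ) (x : EuclideanSpace ℂ ι) :
    inner ℂ t (mulVecE A x) = inner ℂ (mulVecE A.conjTranspose t) x := by
  simp only [EuclideanSpace.inner_eq_star_dotProduct, mulVecE, Matrix.star_mulVec,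
    Matrix.conjTranspose_conjTranspose]
  rw [dotProduct_comm, Matrix.dotProduct_mulVec, dotProduct_comm]

lemma sesqForm_mulVecE {κ' : Type*} [Fintype κ'] (R : Matrix ι ι ℂ) (A : Matrix κ ι ℂ)
    (B : Matrix κ' ι ℂ) (s : EuclideanSpace ℂ κ) (t : EuclideanSpace ℂ κ') :
    sesqForm R (mulVecE A.conjTranspose s) (mulVecE B.conjTranspose t)
      = sesqForm (A * R * B.conjTranspose) s t := by
  simp [sesqForm, mulVecE, Matrix.star_mulVec, Matrix.dotProduct_mulVec, Matrix.vecMul_vecMul,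
    Matrix.mul_assoc]

@[fun_prop]
lemma measurable_mulVecE (A : Matrix κ ι ℂ) : Measurable (mulVecE A) := by
  have : Continuous (mulVecE A) := by
    unfold mulVecE
    exact (PiLp.continuous_toLp 2 _).comp
      (Continuous.matrix_mulVec continuous_const (PiLp.continuous_ofLp 2 _))
  exact this.measurable

lemma inner_eq_sum (x y : EuclideanSpace ℂ ι) : inner ℂ x y = ∑ i, y i * conj (x i) := by
  simp [PiLp.inner_apply]

/-- Characteristic functions use the real inner product, `IsCN` the real part of the complex one. -/
lemma real_inner_eq_re (x y : EuclideanSpace ℂ ι) : inner ℝ x y = (inner ℂ x y).re := by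
  simp [PiLp.inner_apply, Complex.inner]

end SesqForm

/-! ### Second and fourth moments of a real Gaussian. -/

section RealGaussian

/-- The fourth derivative at `0` of the moment generating function `exp(mt + vt²/2)`, differentiated
one order at a time. -/
lemma integral_pow_four_gaussianReal (m : ℝ) (v : NNReal) :
    ∫ x, x ^ 4 ∂gaussianReal m v = m ^ 4 + 6 * m ^ 2 * v + 3 * (v : ℝ) ^ 2 := by
  have h0 : (0 : ℝ) ∈ interior (integrableExpSet id (gaussianReal m v)) := by simp
  have h := iteratedDeriv_mgf_zero h0 4
  have hE : ∀ x : ℝ, HasDerivAt (fun t : ℝ => Real.exp (m * t + v * t ^ 2 / 2))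
      ((m + v * x) * Real.exp (m * x + v * x ^ 2 / 2)) x := by
    intro x
    have h1 : HasDerivAt (fun t : ℝ => m * t + v * t ^ 2 / 2) (m + v * x) x := by
      have := ((hasDerivAt_id x).const_mul m).add
        ((((hasDerivAt_id x).pow 2).const_mul (v : ℝ)).div_const 2)
      refine this.congr_deriv ?_
      simp
      ring
    exact h1.exp.congr_deriv (by ring)
  have hA : ∀ x : ℝ, HasDerivAt (fun t : ℝ => m + v * t) v x := by
    intro x
    simpa using ((hasDerivAt_id x).const_mul (v : ℝ)).const_add m
  have d1 : deriv (fun t : ℝ => Real.exp (m * t + v * t ^ 2 / 2))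
      = fun x => (m + v * x) * Real.exp (m * x + v * x ^ 2 / 2) := funext fun x => (hE x).deriv
  have d2 : deriv (fun x : ℝ => (m + v * x) * Real.exp (m * x + v * x ^ 2 / 2))
      = fun x => (v + (m + v * x) ^ 2) * Real.exp (m * x + v * x ^ 2 / 2) :=
    funext fun x => (((hA x).mul (hE x)).congr_deriv (by ring)).deriv
  have d3 : deriv (fun x : ℝ => (v + (m + v * x) ^ 2) * Real.exp (m * x + v * x ^ 2 / 2))
      = fun x => (3 * v * (m + v * x) + (m + v * x) ^ 3) * Real.exp (m * x + v * x ^ 2 / 2) :=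
    funext fun x => (((((hA x).pow 2).const_add (v : ℝ)).mul (hE x)).congr_deriv
      (by simp; ring)).deriv
  have d4 : deriv (fun x : ℝ =>
        (3 * v * (m + v * x) + (m + v * x) ^ 3) * Real.exp (m * x + v * x ^ 2 / 2))
      = fun x => (3 * v ^ 2 + 6 * v * (m + v * x) ^ 2 + (m + v * x) ^ 4)
          * Real.exp (m * x + v * x ^ 2 / 2) :=
    funext fun x => (((((hA x).const_mul (3 * (v : ℝ))).add ((hA x).pow 3)).mul
      (hE x)).congr_deriv (by simp; ring)).deriv
  rw [mgf_id_gaussianReal] at h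
  simp only [iteratedDeriv_succ, iteratedDeriv_zero, d1, d2, d3, d4] at h
  simp only [Pi.pow_apply, id_eq] at h
  rw [← h]
  simp
  ring

lemma integral_sq_gaussianReal (m : ℝ) (v : NNReal) :
    ∫ x, x ^ 2 ∂gaussianReal m v = m ^ 2 + v := by
  have h := variance_eq_sub (memLp_id_gaussianReal (μ := m) (v := v) 2)
  rw [variance_id_gaussianReal] at h
  simp only [Pi.pow_apply, id_eq, integral_id_gaussianReal] at h
  linarith

end RealGaussian

/-! ### Random variables with finite moments of every order. -/

/-- All moments of `f` are finite. -/
def HasAllMoments {Ω E : Type*} [MeasurableSpace Ω] [NormedAddCommGroup E] (P : Measure Ω)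
    (f : Ω → E) : Prop :=
  ∀ p : NNReal, MemLp f p P

namespace HasAllMoments

variable {Ω : Type*} [MeasurableSpace Ω] {P : Measure Ω} {f g : Ω → ℂ}

lemma add (hf : HasAllMoments P f) (hg : HasAllMoments P g) :
    HasAllMoments P (fun ω => f ω + g ω) := fun p => (hf p).add (hg p)

lemma sum {ι : Type*} (s : Finset ι) {F : ι → Ω → ℂ} (hF : ∀ i ∈ s, HasAllMoments P (F i)) :
    HasAllMoments P (fun ω => ∑ i ∈ s, F i ω) :=
  fun p => memLp_finsetSum _ fun i hi => hF i hi p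

/-- Hölder with both exponents `2p`. Closure under products is the reason for demanding all moments
at once: every polynomial in the signals is then integrable. -/
lemma mul (hf : HasAllMoments P f) (hg : HasAllMoments P g) :
    HasAllMoments P (fun ω => f ω * g ω) := by
  intro p
  have : ENNReal.HolderTriple ((2 * p : NNReal) : ENNReal) ((2 * p : NNReal) : ENNReal) p := by
    constructor
    push_cast
    rcases eq_or_ne p 0 with rfl | hp
    · simp
    · rw [ENNReal.mul_inv (by simp) (by simp), ← add_mul, ENNReal.inv_two_add_inv_two, one_mul]
  exact MemLp.mul (p := ((2 * p : NNReal) : ENNReal)) (hg (2 * p)) (hf (2 * p))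

lemma star (hf : HasAllMoments P f) : HasAllMoments P (fun ω => conj (f ω)) :=
  fun p => (hf p).star

lemma ofReal {f : Ω → ℝ} (hf : HasAllMoments P f) : HasAllMoments P (fun ω => (f ω : ℂ)) :=
  fun p => (hf p).ofReal

lemma integrable {E : Type*} [NormedAddCommGroup E] {f : Ω → E} (hf : HasAllMoments P f) :
    Integrable f P := by
  have := hf 1
  rwa [ENNReal.coe_one, memLp_one_iff_integrable] at this

lemma const_mul (c : ℂ) (hf : HasAllMoments P f) : HasAllMoments P (fun ω => c * f ω) :=
  fun p => (hf p).const_mul c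

lemma integrable_norm_sq (hf : HasAllMoments P f) : Integrable (fun ω => ‖f ω‖ ^ 2) P := by
  have := (hf 2).integrable_norm_pow
  simpa using this

lemma congr_ae {E : Type*} [NormedAddCommGroup E] {f g : Ω → E} (hf : HasAllMoments P f)
    (h : f =ᵐ[P] g) : HasAllMoments P g :=
  fun p => (hf p).ae_eq h

end HasAllMoments

/-! ### Polarization and real coordinates on `ℂ^ι`. -/

lemma re_sesqForm_add {ι : Type*} [Fintype ι] {R : Matrix ι ι ℂ} (hR : R.IsHermitian)
    (s t : EuclideanSpace ℂ ι) :
    (sesqForm R (s + t) (s + t)).re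
      = (sesqForm R s s).re + (sesqForm R t t).re + 2 * (sesqForm R s t).re := by
  simp only [sesqForm_add_left, sesqForm_add_right, sesqForm_swap hR s t, Complex.add_re,
    Complex.conj_re]
  ring

lemma re_sesqForm_sub {ι : Type*} [Fintype ι] {R : Matrix ι ι ℂ} (hR : R.IsHermitian)
    (s t : EuclideanSpace ℂ ι) :
    (sesqForm R (s - t) (s - t)).re
      = (sesqForm R s s).re + (sesqForm R t t).re - 2 * (sesqForm R s t).re := by
  simp only [sesqForm_sub_left, sesqForm_sub_right, sesqForm_swap hR s t, Complex.sub_re,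
    Complex.conj_re]
  ring

/-- The vectors `e_j` and `i e_j`, which form a real basis of `ℂ^ι`. -/
noncomputable def realFrame {ι : Type*} [DecidableEq ι] (a : ι × Bool) : EuclideanSpace ℂ ι :=
  (if a.2 then Complex.I else 1) • EuclideanSpace.single a.1 1

section RealFrame

variable {ι : Type*} [Fintype ι] [DecidableEq ι]

lemma re_inner_realFrame_false (x : EuclideanSpace ℂ ι) (j : ι) :
    (inner ℂ (realFrame (j, false)) x).re = (x j).re := by
  simp [realFrame, EuclideanSpace.inner_single_left]

lemma re_inner_realFrame_true (x : EuclideanSpace ℂ ι) (j : ι) :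
    (inner ℂ (realFrame (j, true)) x).re = (x j).im := by
  simp [realFrame, EuclideanSpace.inner_single_left]

lemma sum_re_inner_realFrame_sq (x : EuclideanSpace ℂ ι) :
    ∑ a, (inner ℂ (realFrame a) x).re ^ 2 = ‖x‖ ^ 2 := by
  rw [Fintype.sum_prod_type, EuclideanSpace.norm_sq_eq]
  refine Finset.sum_congr rfl fun j _ => ?_
  rw [Fintype.sum_bool, re_inner_realFrame_false, re_inner_realFrame_true,
    ← Complex.normSq_eq_norm_sq, Complex.normSq_apply]
  ring

/-- This and the next three lemmas give the entries of the real matrix with blocks `Re R, -Im R, Im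
R, Re R`. Half of it is the covariance of the real and imaginary parts of a `CN(μ, R)` vector. -/
lemma re_sesqForm_realFrame_ff (R : Matrix ι ι ℂ) (i j : ι) :
    (sesqForm R (realFrame (i, false)) (realFrame (j, false))).re = (R i j).re := by
  simp [realFrame, sesqForm_single]

lemma re_sesqForm_realFrame_tt (R : Matrix ι ι ℂ) (i j : ι) :
    (sesqForm R (realFrame (i, true)) (realFrame (j, true))).re = (R i j).re := by
  simp [realFrame, sesqForm_single, sesqForm_smul_left, sesqForm_smul_right]

lemma re_sesqForm_realFrame_tf (R : Matrix ι ι ℂ) (i j : ι) :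
    (sesqForm R (realFrame (i, true)) (realFrame (j, false))).re = (R i j).im := by
  simp [realFrame, sesqForm_single, sesqForm_smul_left]

lemma re_sesqForm_realFrame_ft (R : Matrix ι ι ℂ) (i j : ι) :
    (sesqForm R (realFrame (i, false)) (realFrame (j, true))).re = -(R i j).im := by
  simp [realFrame, sesqForm_single, sesqForm_smul_right]

lemma sum_re_sesqForm_realFrame (R : Matrix ι ι ℂ) :
    ∑ a, (sesqForm R (realFrame a) (realFrame a)).re = 2 * R.trace.re := by
  rw [Fintype.sum_prod_type, Matrix.trace, Complex.re_sum, Finset.mul_sum]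
  refine Finset.sum_congr rfl fun j _ => ?_
  rw [Fintype.sum_bool, re_sesqForm_realFrame_ff, re_sesqForm_realFrame_tt, Matrix.diag_apply]
  ring

/-- Each `|R j l|²` is counted twice, and equals `R j l * R l j` because `R` is Hermitian. -/
lemma sum_re_sesqForm_realFrame_sq {R : Matrix ι ι ℂ} (hR : R.IsHermitian) :
    ∑ a, ∑ b, (sesqForm R (realFrame a) (realFrame b)).re ^ 2 = 2 * (R * R).trace.re := by
  simp only [Fintype.sum_prod_type, Matrix.trace, Matrix.diag_apply, Matrix.mul_apply,
    Complex.re_sum, Finset.mul_sum, Fintype.sum_bool, re_sesqForm_realFrame_ff,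
    re_sesqForm_realFrame_tt, re_sesqForm_realFrame_tf, re_sesqForm_realFrame_ft,
    ← Finset.sum_add_distrib]
  refine Finset.sum_congr rfl fun j _ => Finset.sum_congr rfl fun l _ => ?_
  rw [← hR.apply l j]
  simp
  ring

lemma sum_re_inner_mul_re_sesqForm_realFrame (R : Matrix ι ι ℂ) (μ : EuclideanSpace ℂ ι) :
    ∑ a, ∑ b, (inner ℂ (realFrame a) μ).re * (inner ℂ (realFrame b) μ).re
      * (sesqForm R (realFrame a) (realFrame b)).re = (sesqForm R μ μ).re := by
  simp only [Fintype.sum_prod_type, Fintype.sum_bool, re_sesqForm_realFrame_ff,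
    re_sesqForm_realFrame_tt, re_sesqForm_realFrame_tf, re_sesqForm_realFrame_ft,
    re_inner_realFrame_false, re_inner_realFrame_true, ← Finset.sum_add_distrib]
  simp only [sesqForm, dotProduct, Matrix.mulVec, Finset.mul_sum, Complex.re_sum]
  refine Finset.sum_congr rfl fun j _ => Finset.sum_congr rfl fun l _ => ?_
  simp
  ring

end RealFrame

/-! ### Moments of a complex Gaussian vector. -/

namespace IsCN

variable {Ω : Type*} [MeasurableSpace Ω] {P : Measure Ω} {ι κ : Type*} [Fintype ι] [Fintype κ]
  {X : Ω → EuclideanSpace ℂ ι} {μ : EuclideanSpace ℂ ι} {R : Matrix ι ι ℂ}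

lemma measurable_re_inner (h : IsCN P X μ R) (t : EuclideanSpace ℂ ι) :
    Measurable fun ω => (inner ℂ t (X ω)).re := by
  have := h.measurable
  fun_prop

lemma hasAllMoments_re_inner (h : IsCN P X μ R) (t : EuclideanSpace ℂ ι) :
    HasAllMoments P fun ω => (inner ℂ t (X ω)).re := by
  intro p
  have h1 := memLp_id_gaussianReal (μ := (inner ℂ t μ).re)
    (v := ((star t.ofLp ⬝ᵥ R.mulVec t.ofLp).re / 2).toNNReal) p
  rw [← h.map_re_inner t] at h1
  exact (memLp_map_measure_iff h1.aestronglyMeasurable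
    (h.measurable_re_inner t).aemeasurable).1 h1

lemma integral_comp_re_inner (h : IsCN P X μ R) (t : EuclideanSpace ℂ ι) {f : ℝ → ℝ}
    (hf : Continuous f) :
    ∫ ω, f (inner ℂ t (X ω)).re ∂P
      = ∫ x, f x ∂gaussianReal (inner ℂ t μ).re ((sesqForm R t t).re / 2).toNNReal := by
  rw [sesqForm, ← h.map_re_inner t, integral_map (h.measurable_re_inner t).aemeasurable
    hf.aestronglyMeasurable]

lemma coe_variance (hR : R.PosSemidef) (t : EuclideanSpace ℂ ι) :
    (((sesqForm R t t).re / 2).toNNReal : ℝ) = (sesqForm R t t).re / 2 :=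
  Real.coe_toNNReal _ (by linarith [sesqForm_self_nonneg hR t])

lemma integral_re_inner (h : IsCN P X μ R) (t : EuclideanSpace ℂ ι) :
    ∫ ω, (inner ℂ t (X ω)).re ∂P = (inner ℂ t μ).re := by
  have := h.integral_comp_re_inner t continuous_id
  simp only [id_eq] at this
  rw [this, integral_id_gaussianReal]

lemma integral_re_inner_sq (h : IsCN P X μ R) (hR : R.PosSemidef) (t : EuclideanSpace ℂ ι) :
    ∫ ω, (inner ℂ t (X ω)).re ^ 2 ∂P = (inner ℂ t μ).re ^ 2 + (sesqForm R t t).re / 2 := by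
  rw [h.integral_comp_re_inner t (f := fun x => x ^ 2) (by fun_prop), integral_sq_gaussianReal,
    coe_variance hR]

lemma integral_re_inner_pow_four (h : IsCN P X μ R) (hR : R.PosSemidef)
    (t : EuclideanSpace ℂ ι) :
    ∫ ω, (inner ℂ t (X ω)).re ^ 4 ∂P = (inner ℂ t μ).re ^ 4
      + 3 * (inner ℂ t μ).re ^ 2 * (sesqForm R t t).re
      + 3 / 4 * (sesqForm R t t).re ^ 2 := by
  rw [h.integral_comp_re_inner t (f := fun x => x ^ 4) (by fun_prop),
    integral_pow_four_gaussianReal, coe_variance hR]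
  ring

lemma integrable_re_inner_pow (h : IsCN P X μ R) (t : EuclideanSpace ℂ ι) (n : ℕ) :
    Integrable (fun ω => (inner ℂ t (X ω)).re ^ n) P := by
  rcases Nat.eq_zero_or_pos n with rfl | hn
  -- For exponent `0` the integrand is `1`; `P` is finite because its pushforward is a Gaussian law.
  · have h1 : IsFiniteMeasure (P.map fun ω => (inner ℂ (0 : EuclideanSpace ℂ ι) (X ω)).re) := by
      rw [h.map_re_inner]; infer_instance
    have : IsFiniteMeasure P :=
      Measure.isFiniteMeasure_of_map (h.measurable_re_inner 0).aemeasurable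
    simp
  · have h1 := (h.hasAllMoments_re_inner t n)
    refine (h1.integrable_norm_pow (by omega)).mono
      ((h.measurable_re_inner t).pow_const n).aestronglyMeasurable (.of_forall fun ω => ?_)
    simp

lemma integral_re_inner_mul_re_inner (h : IsCN P X μ R) (hR : R.PosSemidef)
    (s t : EuclideanSpace ℂ ι) :
    ∫ ω, (inner ℂ s (X ω)).re * (inner ℂ t (X ω)).re ∂P
      = (inner ℂ s μ).re * (inner ℂ t μ).re + (sesqForm R s t).re / 2 := by
  have e : ∀ ω, (inner ℂ s (X ω)).re * (inner ℂ t (X ω)).re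
      = ((inner ℂ (s + t) (X ω)).re ^ 2 - (inner ℂ s (X ω)).re ^ 2
        - (inner ℂ t (X ω)).re ^ 2) / 2 := by
    intro ω
    rw [inner_add_left, Complex.add_re]
    ring
  simp only [e]
  have i1 := h.integrable_re_inner_pow (s + t) 2
  have i2 := h.integrable_re_inner_pow s 2
  have i3 := h.integrable_re_inner_pow t 2
  have i12 : Integrable (fun ω => (inner ℂ (s + t) (X ω)).re ^ 2 - (inner ℂ s (X ω)).re ^ 2) P :=
    i1.sub i2
  rw [integral_div, integral_sub i12 i3, integral_sub i1 i2,
    h.integral_re_inner_sq hR, h.integral_re_inner_sq hR, h.integral_re_inner_sq hR,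
    re_sesqForm_add hR.isHermitian, inner_add_left, Complex.add_re]
  ring

/-- Polarization `12 x²y² = (x+y)⁴ + (x-y)⁴ - 2x⁴ - 2y⁴`: since `x ± y` are again of the form
`Re(tᴴX)`, one-dimensional fourth moments are enough. -/
lemma integral_re_inner_sq_mul_re_inner_sq (h : IsCN P X μ R) (hR : R.PosSemidef)
    (s t : EuclideanSpace ℂ ι) :
    Integrable (fun ω => (inner ℂ s (X ω)).re ^ 2 * (inner ℂ t (X ω)).re ^ 2) P ∧
    ∫ ω, (inner ℂ s (X ω)).re ^ 2 * (inner ℂ t (X ω)).re ^ 2 ∂P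
      = ((inner ℂ s μ).re ^ 2 + (sesqForm R s s).re / 2)
          * ((inner ℂ t μ).re ^ 2 + (sesqForm R t t).re / 2)
        + 2 * ((inner ℂ s μ).re * (inner ℂ t μ).re * (sesqForm R s t).re)
        + (sesqForm R s t).re ^ 2 / 2 := by
  have e : ∀ ω, (inner ℂ s (X ω)).re ^ 2 * (inner ℂ t (X ω)).re ^ 2
      = ((inner ℂ (s + t) (X ω)).re ^ 4 + (inner ℂ (s - t) (X ω)).re ^ 4
        - 2 * (inner ℂ s (X ω)).re ^ 4 - 2 * (inner ℂ t (X ω)).re ^ 4) / 12 := by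
    intro ω
    rw [inner_add_left, inner_sub_left, Complex.add_re, Complex.sub_re]
    ring
  simp only [e]
  have i1 := h.integrable_re_inner_pow (s + t) 4
  have i1' := h.integrable_re_inner_pow (s - t) 4
  have i2 := (h.integrable_re_inner_pow s 4).const_mul 2
  have i3 := (h.integrable_re_inner_pow t 4).const_mul 2
  have j1 : Integrable (fun ω => (inner ℂ (s + t) (X ω)).re ^ 4
    + (inner ℂ (s - t) (X ω)).re ^ 4) P := i1.add i1'
  have j2 : Integrable (fun ω => (inner ℂ (s + t) (X ω)).re ^ 4 + (inner ℂ (s - t) (X ω)).re ^ 4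
    - 2 * (inner ℂ s (X ω)).re ^ 4) P := j1.sub i2
  refine ⟨(j2.sub i3).div_const 12, ?_⟩
  rw [integral_div, integral_sub j2 i3, integral_sub j1 i2,
    integral_add i1 i1', integral_const_mul, integral_const_mul]
  simp only [h.integral_re_inner_pow_four hR]
  rw [re_sesqForm_add hR.isHermitian, re_sesqForm_sub hR.isHermitian, inner_add_left,
    inner_sub_left, Complex.add_re, Complex.sub_re]
  ring

lemma hasAllMoments_apply (h : IsCN P X μ R) (j : ι) : HasAllMoments P fun ω => X ω j := by
  classical
  have h1 := (h.hasAllMoments_re_inner (realFrame (j, false))).ofReal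
  have h2 := (h.hasAllMoments_re_inner (realFrame (j, true))).ofReal
  have h3 := h1.add (h2.const_mul Complex.I)
  simp only [re_inner_realFrame_false, re_inner_realFrame_true] at h3
  refine h3.congr_ae (.of_forall fun ω => ?_)
  simp [mul_comm Complex.I, Complex.re_add_im]

lemma integral_apply (h : IsCN P X μ R) (j : ι) : ∫ ω, X ω j ∂P = μ j := by
  classical
  have h0 := (h.hasAllMoments_apply j).integrable
  have h1 := h.integral_re_inner (realFrame (j, false))
  have h2 := h.integral_re_inner (realFrame (j, true))
  simp only [re_inner_realFrame_false, re_inner_realFrame_true] at h1 h2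
  apply Complex.ext
  · rw [← h1, ← RCLike.re_eq_complex_re, ← integral_re h0]
  · rw [← h2, ← RCLike.im_eq_complex_im, ← integral_im h0]

/-- Circular symmetry: two real covariances, each equal to half of the real (or imaginary) part of
`R i j`, add up to the whole. -/
lemma integral_apply_mul_conj (h : IsCN P X μ R) (hR : R.PosSemidef) (i j : ι) :
    ∫ ω, X ω i * conj (X ω j) ∂P = R i j + μ i * conj (μ j) := by
  classical
  have h0 := ((h.hasAllMoments_apply i).mul (h.hasAllMoments_apply j).star).integrable
  have i1 := fun b c => (((h.hasAllMoments_re_inner (realFrame (i, b))).ofReal.mul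
    (h.hasAllMoments_re_inner (realFrame (j, c))).ofReal).integrable).re
  simp only [← Complex.ofReal_mul, RCLike.re_eq_complex_re, Complex.ofReal_re] at i1
  have h1 := fun b c => h.integral_re_inner_mul_re_inner hR (realFrame (i, b)) (realFrame (j, c))
  have iff := i1 false false
  have ift := i1 false true
  have itf := i1 true false
  have itt := i1 true true
  have hff := h1 false false
  have hft := h1 false true
  have htf := h1 true false
  have htt := h1 true true
  simp only [re_inner_realFrame_false, re_inner_realFrame_true, re_sesqForm_realFrame_ff,
    re_sesqForm_realFrame_tt, re_sesqForm_realFrame_tf, re_sesqForm_realFrame_ft] at *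
  apply Complex.ext
  · rw [← RCLike.re_eq_complex_re, ← integral_re h0]
    simp only [RCLike.re_eq_complex_re, Complex.mul_re, Complex.conj_re, Complex.conj_im,
      Complex.add_re, mul_neg, sub_neg_eq_add]
    rw [integral_add iff itt, hff, htt]
    ring
  · rw [← RCLike.im_eq_complex_im, ← integral_im h0]
    simp only [RCLike.im_eq_complex_im, Complex.mul_im, Complex.conj_re, Complex.conj_im,
      Complex.add_im, mul_neg]
    simp only [neg_add_eq_sub]
    rw [integral_sub itf ift, htf, hft]
    ring

/-- `‖X‖⁴` is a double sum over the real basis. The products of second moments give `(E‖X‖²)²`, the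
squared covariances give `tr R²`, and the mean-covariance terms give `2 μᴴRμ`. -/
lemma integral_norm_pow_four (h : IsCN P X μ R) (hR : R.PosSemidef) :
    ∫ ω, (‖X ω‖ ^ 2) ^ 2 ∂P
      = (‖μ‖ ^ 2 + R.trace.re) ^ 2 + (R * R).trace.re + 2 * (sesqForm R μ μ).re := by
  classical
  simp only [← sum_re_inner_realFrame_sq (X _)]
  have hsq : ∀ ω, (∑ a, (inner ℂ (realFrame a) (X ω)).re ^ 2) ^ 2
      = ∑ a, ∑ b, (inner ℂ (realFrame a) (X ω)).re ^ 2 * (inner ℂ (realFrame b) (X ω)).re ^ 2 :=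
    fun ω => by rw [sq, Finset.sum_mul_sum]
  have hint := fun a b => h.integral_re_inner_sq_mul_re_inner_sq hR (realFrame a) (realFrame b)
  simp only [hsq]
  rw [integral_finsetSum _ fun a _ => integrable_finsetSum _ fun b _ => (hint a b).1]
  simp_rw [integral_finsetSum _ fun b _ => (hint _ b).1, (hint _ _).2, Finset.sum_add_distrib]
  rw [← Finset.sum_mul_sum]
  simp only [← Finset.mul_sum, ← Finset.sum_div, Finset.sum_add_distrib]
  rw [sum_re_inner_mul_re_sesqForm_realFrame, sum_re_sesqForm_realFrame_sq hR.isHermitian,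
    sum_re_sesqForm_realFrame, sum_re_inner_realFrame_sq]
  ring

end IsCN

/-! ### Linear images, stacking and independence of complex Gaussian vectors. -/

namespace IsCN

variable {Ω : Type*} [MeasurableSpace Ω] {P : Measure Ω}
  {ι κ ι' : Type*} [Fintype ι] [Fintype κ] [Fintype ι']
  {X : Ω → EuclideanSpace ℂ ι} {μ : EuclideanSpace ℂ ι} {R : Matrix ι ι ℂ}

lemma affine (h : IsCN P X μ R) (A : Matrix κ ι ℂ) (b : EuclideanSpace ℂ κ) :
    IsCN P (fun ω => mulVecE A (X ω) + b) (mulVecE A μ + b) (A * R * A.conjTranspose) where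
  measurable := by
    have := h.measurable
    fun_prop
  map_re_inner t := by
    have h1 := gaussianReal_map_add_const (μ := (inner ℂ (mulVecE A.conjTranspose t) μ).re)
      (v := ((sesqForm R (mulVecE A.conjTranspose t) (mulVecE A.conjTranspose t)).re / 2).toNNReal)
      (inner ℂ t b).re
    rw [sesqForm, ← h.map_re_inner, Measure.map_map (by fun_prop) (h.measurable_re_inner _)] at h1
    change _ = gaussianReal _ (((sesqForm (A * R * A.conjTranspose) t t).re / 2).toNNReal)
    rw [← sesqForm_mulVecE, inner_add_right, Complex.add_re, inner_mulVecE]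
    refine Eq.trans ?_ h1
    congr 1
    ext ω
    simp [inner_mulVecE]

lemma congr_cov {R' : Matrix ι ι ℂ} {μ' : EuclideanSpace ℂ ι} (h : IsCN P X μ R) (hμ : μ = μ')
    (hR : R = R') : IsCN P X μ' R' := by
  subst hμ hR
  exact h

/-- Supplies the joint Gaussian law of channel and noise: a functional of the stacked vector is a
sum of two independent real Gaussians. -/
lemma stack {Y : Ω → EuclideanSpace ℂ ι'} {ν : EuclideanSpace ℂ ι'} {Q : Matrix ι' ι' ℂ}
    (hX : IsCN P X μ R) (hY : IsCN P Y ν Q) (hR : R.PosSemidef) (hQ : Q.PosSemidef)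
    (hXY : IndepFun X Y P) :
    IsCN P (fun ω => WithLp.toLp 2 (Sum.elim (X ω).ofLp (Y ω).ofLp))
      (WithLp.toLp 2 (Sum.elim μ.ofLp ν.ofLp)) (Matrix.fromBlocks R 0 0 Q) where
  measurable := by
    have h1 := hX.measurable
    have h2 := hY.measurable
    refine (WithLp.measurable_toLp 2 _).comp (measurable_pi_lambda _ fun j => ?_)
    cases j <;> simp <;> fun_prop
  map_re_inner t := by
    let t₁ : EuclideanSpace ℂ ι := WithLp.toLp 2 fun i => t (Sum.inl i)
    let t₂ : EuclideanSpace ℂ ι' := WithLp.toLp 2 fun i => t (Sum.inr i)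
    have hin : ∀ (x : EuclideanSpace ℂ ι) (y : EuclideanSpace ℂ ι'),
        inner ℂ t (WithLp.toLp 2 (Sum.elim x.ofLp y.ofLp)) = inner ℂ t₁ x + inner ℂ t₂ y := by
      intro x y
      simp [PiLp.inner_apply, t₁, t₂]
    have hv : star t.ofLp ⬝ᵥ (Matrix.fromBlocks R 0 0 Q).mulVec t.ofLp
        = sesqForm R t₁ t₁ + sesqForm Q t₂ t₂ := by
      simp [sesqForm, dotProduct, Matrix.mulVec, t₁, t₂]
    have hind : IndepFun (fun ω => (inner ℂ t₁ (X ω)).re) (fun ω => (inner ℂ t₂ (Y ω)).re) P :=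
      hXY.comp (φ := fun x => (inner ℂ t₁ x).re) (ψ := fun y => (inner ℂ t₂ y).re)
        (by fun_prop) (by fun_prop)
    have := gaussianReal_add_gaussianReal_of_indepFun hind (hX.map_re_inner t₁)
      (hY.map_re_inner t₂)
    simp only [hin, hv, Complex.add_re, add_div]
    rw [Real.toNNReal_add (by linarith [sesqForm_self_nonneg hR t₁])
      (by linarith [sesqForm_self_nonneg hQ t₂])]
    exact this

/-- The value at `t` is the characteristic function of the real Gaussian `Re(tᴴX)` at `1`; its
variance `tᴴRt/2`, halved once more, gives the `1/4`. -/
lemma charFun_map (h : IsCN P X μ R) (hR : R.PosSemidef) (t : EuclideanSpace ℂ ι) :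
    charFun (P.map X) t
      = Complex.exp ((inner ℂ t μ).re * Complex.I - (sesqForm R t t).re / 4) := by
  have h1 : charFun (P.map X) t = charFun (P.map fun ω => (inner ℂ t (X ω)).re) 1 := by
    rw [charFun_apply, charFun_apply, integral_map h.measurable.aemeasurable (by fun_prop),
      integral_map (h.measurable_re_inner t).aemeasurable (by fun_prop)]
    refine integral_congr_ae (.of_forall fun ω => ?_)
    simp only [real_inner_comm, real_inner_eq_re]
    simp
  rw [h1, h.map_re_inner, charFun_gaussianReal]
  change Complex.exp (_ - (((((sesqForm R t t).re / 2).toNNReal : ℝ)) : ℂ) * _ / 2) = _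
  rw [coe_variance hR]
  congr 1
  push_cast
  ring

/-- Uncorrelated implies independent: the joint characteristic function at `(t₁, t₂)` is that of `X`
at `Aᴴt₁ + Bᴴt₂`, and it factors once the cross terms of the quadratic form vanish. -/
lemma indepFun_mulVecE [IsProbabilityMeasure P] (h : IsCN P X μ R) (hR : R.PosSemidef)
    (A : Matrix κ ι ℂ) (B : Matrix ι' ι ℂ) (hAB : A * R * B.conjTranspose = 0) :
    IndepFun (fun ω => mulVecE A (X ω)) (fun ω => mulVecE B (X ω)) P := by
  have hA := (h.affine A 0)
  have hB := (h.affine B 0)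
  simp only [add_zero] at hA hB
  rw [indepFun_iff_charFun_prod hA.measurable.aemeasurable hB.measurable.aemeasurable]
  intro t
  have h1 : charFun (P.map fun ω => WithLp.toLp 2 (mulVecE A (X ω), mulVecE B (X ω))) t
      = charFun (P.map X) (mulVecE A.conjTranspose t.ofLp.1 + mulVecE B.conjTranspose t.ofLp.2) := by
    have hX := h.measurable
    rw [charFun_apply, charFun_apply, integral_map hX.aemeasurable (by fun_prop),
      integral_map (by fun_prop) (by fun_prop)]
    refine integral_congr_ae (.of_forall fun ω => ?_)
    simp only [WithLp.prod_inner_apply, real_inner_eq_re, inner_add_right]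
    congr 4 <;>
      rw [← inner_conj_symm, Complex.conj_re, inner_mulVecE, ← inner_conj_symm, Complex.conj_re]
  have hBA : B * R * A.conjTranspose = 0 := by
    have := congrArg Matrix.conjTranspose hAB
    simpa [Matrix.conjTranspose_mul, hR.isHermitian.eq, Matrix.mul_assoc] using this
  rw [h1, h.charFun_map hR, hA.charFun_map (hR.mul_mul_conjTranspose_same A),
    hB.charFun_map (hR.mul_mul_conjTranspose_same B), ← Complex.exp_add]
  simp only [sesqForm_add_left, sesqForm_add_right, sesqForm_mulVecE, hAB, hBA]
  simp only [inner_add_left, ← inner_mulVecE, Complex.add_re]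
  congr 1
  simp [sesqForm]
  ring

lemma hasAllMoments_inner {Y : Ω → EuclideanSpace ℂ ι} {ν : EuclideanSpace ℂ ι}
    {Q : Matrix ι ι ℂ} (hX : IsCN P X μ R) (hY : IsCN P Y ν Q) :
    HasAllMoments P fun ω => inner ℂ (X ω) (Y ω) := by
  simp only [inner_eq_sum]
  exact HasAllMoments.sum _ fun i _ =>
    (hY.hasAllMoments_apply i).mul (hX.hasAllMoments_apply i).star

/-! ### Moments of inner products of Gaussian vectors. -/

section Indep

variable {Y : Ω → EuclideanSpace ℂ ι} {ν : EuclideanSpace ℂ ι} {Q : Matrix ι ι ℂ}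

lemma integral_inner (hX : IsCN P X μ R) (hY : IsCN P Y ν Q) (hXY : IndepFun X Y P) :
    ∫ ω, inner ℂ (X ω) (Y ω) ∂P = inner ℂ μ ν := by
  simp only [inner_eq_sum]
  rw [integral_finsetSum _ fun i _ =>
    ((hY.hasAllMoments_apply i).mul (hX.hasAllMoments_apply i).star).integrable]
  refine Finset.sum_congr rfl fun i _ => ?_
  have hind : IndepFun (fun ω => Y ω i) (fun ω => conj (X ω i)) P :=
    hXY.symm.comp (φ := fun y : EuclideanSpace ℂ ι => y i)
      (ψ := fun x : EuclideanSpace ℂ ι => conj (x i))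
      (by fun_prop) (by fun_prop)
  rw [hind.integral_fun_mul_eq_mul_integral (hY.hasAllMoments_apply i 1).aestronglyMeasurable
    ((hX.hasAllMoments_apply i).star 1).aestronglyMeasurable, hY.integral_apply,
    integral_conj, hX.integral_apply]

/-- By independence the expectation is `tr((Q + ννᴴ)(R + μμᴴ))`, written out entrywise; expanding
gives the four terms. -/
lemma integral_norm_inner_sq (hX : IsCN P X μ R) (hY : IsCN P Y ν Q) (hR : R.PosSemidef)
    (hQ : Q.PosSemidef) (hXY : IndepFun X Y P) :
    ∫ ω, ‖inner ℂ (X ω) (Y ω)‖ ^ 2 ∂P = ‖inner ℂ μ ν‖ ^ 2 + (sesqForm R ν ν).re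
      + (sesqForm Q μ μ).re + (Q * R).trace.re := by
  have hexp : ∀ ω, ((‖inner ℂ (X ω) (Y ω)‖ ^ 2 : ℝ) : ℂ)
      = ∑ i, ∑ j, (Y ω i * conj (Y ω j)) * (X ω j * conj (X ω i)) := by
    intro ω
    push_cast
    rw [← Complex.mul_conj']
    simp only [inner_eq_sum, map_sum, Finset.sum_mul_sum, map_mul,
      Complex.conj_conj]
    refine Finset.sum_congr rfl fun i _ => Finset.sum_congr rfl fun j _ => by ring
  have hmX := fun i j => (hX.hasAllMoments_apply i).mul (hX.hasAllMoments_apply j).star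
  have hmY := fun i j => (hY.hasAllMoments_apply i).mul (hY.hasAllMoments_apply j).star
  have key : ((∫ ω, ‖inner ℂ (X ω) (Y ω)‖ ^ 2 ∂P : ℝ) : ℂ)
      = ∑ i, ∑ j, (Q i j + ν i * conj (ν j)) * (R j i + μ j * conj (μ i)) := by
    rw [← integral_complex_ofReal]
    simp only [hexp]
    rw [integral_finsetSum _ fun i _ => integrable_finsetSum _ fun j _ =>
      ((hmY i j).mul (hmX j i)).integrable]
    refine Finset.sum_congr rfl fun i _ => ?_
    rw [integral_finsetSum _ fun j _ => ((hmY i j).mul (hmX j i)).integrable]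
    refine Finset.sum_congr rfl fun j _ => ?_
    have hind : IndepFun (fun ω => Y ω i * conj (Y ω j)) (fun ω => X ω j * conj (X ω i)) P :=
      hXY.symm.comp (φ := fun y : EuclideanSpace ℂ ι => y i * conj (y j))
        (ψ := fun x : EuclideanSpace ℂ ι => x j * conj (x i)) (by fun_prop) (by fun_prop)
    rw [hind.integral_fun_mul_eq_mul_integral (hmY i j 1).aestronglyMeasurable
      (hmX j i 1).aestronglyMeasurable, hY.integral_apply_mul_conj hQ,
      hX.integral_apply_mul_conj hR]
  have e1 : ((‖(inner ℂ μ ν : ℂ)‖ ^ 2 : ℝ) : ℂ)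
      = ∑ i, ∑ j, (ν i * conj (ν j)) * (μ j * conj (μ i)) := by
    push_cast
    rw [← Complex.mul_conj']
    simp only [inner_eq_sum, map_sum, Finset.sum_mul_sum, map_mul,
      Complex.conj_conj]
    refine Finset.sum_congr rfl fun i _ => Finset.sum_congr rfl fun j _ => by ring
  have e2 : sesqForm R ν ν = ∑ i, ∑ j, (ν i * conj (ν j)) * R j i := by
    rw [Finset.sum_comm]
    simp only [sesqForm, dotProduct, Matrix.mulVec, Finset.mul_sum]
    refine Finset.sum_congr rfl fun i _ => Finset.sum_congr rfl fun j _ => ?_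
    simp only [Pi.star_apply, RCLike.star_def]
    ring
  have e3 : sesqForm Q μ μ = ∑ i, ∑ j, Q i j * (μ j * conj (μ i)) := by
    simp only [sesqForm, dotProduct, Matrix.mulVec, Finset.mul_sum]
    refine Finset.sum_congr rfl fun i _ => Finset.sum_congr rfl fun j _ => ?_
    simp only [Pi.star_apply, RCLike.star_def]
    ring
  have e4 : (Q * R).trace = ∑ i, ∑ j, Q i j * R j i := by
    simp [Matrix.trace, Matrix.mul_apply]
  have e5 : ((∫ ω, ‖inner ℂ (X ω) (Y ω)‖ ^ 2 ∂P : ℝ) : ℂ)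
      = ((‖(inner ℂ μ ν : ℂ)‖ ^ 2 : ℝ) : ℂ) + sesqForm R ν ν + sesqForm Q μ μ + (Q * R).trace := by
    rw [key, e1, e2, e3, e4]
    simp only [← Finset.sum_add_distrib]
    refine Finset.sum_congr rfl fun i _ => Finset.sum_congr rfl fun j _ => by ring
  have := congrArg Complex.re e5
  simpa only [Complex.add_re, Complex.ofReal_re] using this

lemma integral_norm_sq (hX : IsCN P X μ R) (hR : R.PosSemidef) :
    ∫ ω, ‖X ω‖ ^ 2 ∂P = ‖μ‖ ^ 2 + R.trace.re := by
  classical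
  simp only [← sum_re_inner_realFrame_sq (X _)]
  rw [integral_finsetSum _ fun a _ => hX.integrable_re_inner_pow _ 2]
  simp only [hX.integral_re_inner_sq hR, Finset.sum_add_distrib, ← Finset.sum_div]
  rw [sum_re_inner_realFrame_sq, sum_re_sesqForm_realFrame]
  ring

/-- Moments of `Xᴴ (X + Y)` for an independent zero-mean `Y`. -/
lemma integral_inner_add_self (hX : IsCN P X μ R) (hY : IsCN P Y 0 Q) (hR : R.PosSemidef)
    (hXY : IndepFun X Y P) :
    ∫ ω, inner ℂ (X ω) (X ω + Y ω) ∂P = ((‖μ‖ ^ 2 + R.trace.re : ℝ) : ℂ) := by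
  simp only [inner_add_right]
  rw [integral_add (hX.hasAllMoments_inner hX).integrable (hX.hasAllMoments_inner hY).integrable,
    hX.integral_inner hY hXY, inner_zero_right, add_zero, ← hX.integral_norm_sq hR,
    ← integral_complex_ofReal]
  refine integral_congr_ae (.of_forall fun ω => ?_)
  simp [inner_self_eq_norm_sq_to_K]

/-- The fourth moment of `X` plus `E|XᴴY|²`; the cross term has mean zero because `Y` has. Written
through `R + Q`, the covariance of `X + Y`, which will be the channel covariance when `X` is the
estimate and `Y` the error. -/
lemma integral_norm_inner_add_self_sq (hX : IsCN P X μ R) (hY : IsCN P Y 0 Q)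
    (hR : R.PosSemidef) (hQ : Q.PosSemidef) (hXY : IndepFun X Y P) :
    ∫ ω, ‖inner ℂ (X ω) (X ω + Y ω)‖ ^ 2 ∂P = (‖μ‖ ^ 2 + R.trace.re) ^ 2
      + (sesqForm R μ μ).re + (sesqForm (R + Q) μ μ).re + ((R + Q) * R).trace.re := by
  have hXX := hX.hasAllMoments_inner hX
  have hXYm := hX.hasAllMoments_inner hY
  have hcross := hXX.mul hXYm
  have hexp : ∀ ω, ‖inner ℂ (X ω) (X ω + Y ω)‖ ^ 2 = (‖X ω‖ ^ 2) ^ 2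
      + 2 * (inner ℂ (X ω) (X ω) * inner ℂ (X ω) (Y ω)).re + ‖inner ℂ (X ω) (Y ω)‖ ^ 2 := by
    intro ω
    have h1 : inner ℂ (X ω) (X ω) = ((‖X ω‖ ^ 2 : ℝ) : ℂ) := by
      simp [inner_self_eq_norm_sq_to_K]
    rw [inner_add_right, h1, ← Complex.normSq_eq_norm_sq, ← Complex.normSq_eq_norm_sq,
      Complex.normSq_apply, Complex.normSq_apply, Complex.re_ofReal_mul, Complex.add_re,
      Complex.add_im, Complex.ofReal_re, Complex.ofReal_im]
    ring
  have hz : ∫ ω, inner ℂ (X ω) (X ω) * inner ℂ (X ω) (Y ω) ∂P = 0 := by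
    simp only [inner_eq_sum (X _) (Y _), Finset.mul_sum]
    rw [integral_finsetSum _ fun i _ => (hXX.mul ((hY.hasAllMoments_apply i).mul
      (hX.hasAllMoments_apply i).star)).integrable]
    refine Finset.sum_eq_zero fun i _ => ?_
    have hind : IndepFun (fun ω => inner ℂ (X ω) (X ω) * conj (X ω i)) (fun ω => Y ω i) P :=
      hXY.comp (φ := fun x : EuclideanSpace ℂ ι => inner ℂ x x * conj (x i))
        (ψ := fun y : EuclideanSpace ℂ ι => y i) (by fun_prop) (by fun_prop)
    have := hind.integral_fun_mul_eq_mul_integral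
      ((hXX.mul (hX.hasAllMoments_apply i).star) 1).aestronglyMeasurable
      (hY.hasAllMoments_apply i 1).aestronglyMeasurable
    rw [hY.integral_apply] at this
    simp only [PiLp.zero_apply, mul_zero] at this
    rw [← this]
    refine integral_congr_ae (.of_forall fun ω => ?_)
    ring
  have i1 : Integrable (fun ω => (‖X ω‖ ^ 2) ^ 2) P := by
    refine hXX.integrable_norm_sq.congr (.of_forall fun ω => ?_)
    simp [inner_self_eq_norm_sq_to_K]
  have i2 : Integrable (fun ω => 2 * (inner ℂ (X ω) (X ω) * inner ℂ (X ω) (Y ω)).re) P :=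
    hcross.integrable.re.const_mul 2
  have i12 : Integrable (fun ω => (‖X ω‖ ^ 2) ^ 2
      + 2 * (inner ℂ (X ω) (X ω) * inner ℂ (X ω) (Y ω)).re) P := i1.add i2
  have hz' : ∫ ω, (inner ℂ (X ω) (X ω) * inner ℂ (X ω) (Y ω)).re ∂P = 0 := by
    have := integral_re hcross.integrable
    rw [hz] at this
    simpa using this
  simp only [hexp]
  rw [integral_add i12 hXYm.integrable_norm_sq, integral_add i1 i2, integral_const_mul, hz',
    hX.integral_norm_pow_four hR, hX.integral_norm_inner_sq hY hR hQ hXY]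
  have e1 : sesqForm (R + Q) μ μ = sesqForm R μ μ + sesqForm Q μ μ := by
    simp [sesqForm, Matrix.add_mulVec]
  have e2 : sesqForm R 0 (0 : EuclideanSpace ℂ ι) = 0 := by simp [sesqForm]
  rw [e1, e2, add_mul, Matrix.trace_add]
  simp
  ring

end Indep

end IsCN

/-! ### MMSE estimation of a Gaussian vector in white noise. -/

lemma posSemidef_fromBlocks_diag {ι κ : Type*} [Fintype ι] [Fintype κ]
    {R : Matrix ι ι ℂ} {Q : Matrix κ κ ℂ} (hR : R.PosSemidef) (hQ : Q.PosSemidef) :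
    (Matrix.fromBlocks R 0 0 Q).PosSemidef := by
  refine Matrix.PosSemidef.of_dotProduct_mulVec_nonneg ?_ fun x => ?_
  · rw [Matrix.IsHermitian, Matrix.fromBlocks_conjTranspose, hR.isHermitian.eq,
      hQ.isHermitian.eq, Matrix.conjTranspose_zero, Matrix.conjTranspose_zero]
  · have : star x ⬝ᵥ (Matrix.fromBlocks R 0 0 Q).mulVec x
        = star (x ∘ Sum.inl) ⬝ᵥ R.mulVec (x ∘ Sum.inl)
          + star (x ∘ Sum.inr) ⬝ᵥ Q.mulVec (x ∘ Sum.inr) := by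
      simp [dotProduct, Matrix.mulVec]
    rw [this]
    exact add_nonneg (hR.dotProduct_mulVec_nonneg _) (hQ.dotProduct_mulVec_nonneg _)

lemma posSemidef_sq_smul_one {ι : Type*} [Fintype ι] [DecidableEq ι] (σ : ℝ) :
    (((σ ^ 2 : ℝ) : ℂ) • (1 : Matrix ι ι ℂ)).PosSemidef :=
  Matrix.PosSemidef.one.smul (by exact_mod_cast sq_nonneg σ)

lemma mulVecE_fromCols {ι κ ι' : Type*} [Fintype ι] [Fintype κ] [Fintype ι']
    (A : Matrix κ ι ℂ) (B : Matrix κ ι' ℂ) (x : EuclideanSpace ℂ ι) (y : EuclideanSpace ℂ ι') :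
    mulVecE (Matrix.fromCols A B) (WithLp.toLp 2 (Sum.elim x.ofLp y.ofLp))
      = mulVecE A x + mulVecE B y := by
  simp [mulVecE, Matrix.fromCols_mulVec]

/-- The covariance of two linear images of a stacked vector with independent blocks. -/
lemma fromCols_mul_fromBlocks_mul_conjTranspose {ι κ κ' : Type*} [Fintype ι] [Fintype κ]
    (A B : Matrix κ ι ℂ) (C D : Matrix κ' ι ℂ) (R Q : Matrix ι ι ℂ) :
    Matrix.fromCols A B * Matrix.fromBlocks R 0 0 Q * (Matrix.fromCols C D).conjTranspose
      = A * R * C.conjTranspose + B * Q * D.conjTranspose := by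
  rw [Matrix.fromCols_mul_fromBlocks, Matrix.conjTranspose_fromCols_eq_fromRows_conjTranspose,
    Matrix.fromCols_mul_fromRows]
  simp

/-- The linear MMSE estimator of a complex Gaussian vector `g` from `a g + n` with white Gaussian
noise `n`: the observation is independent of the estimation error. -/
theorem exists_mmse_estimator {Ω : Type*} [MeasurableSpace Ω] {P : Measure Ω}
    [IsProbabilityMeasure P] {ι : Type*} [Fintype ι] [DecidableEq ι]
    {g n : Ω → EuclideanSpace ℂ ι} {μ : EuclideanSpace ℂ ι} {R : Matrix ι ι ℂ} {σ : ℝ} (a : ℝ)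
    (hσ : 0 < σ) (hg : IsCN P g μ R) (hR : R.PosSemidef)
    (hn : IsCN P n 0 (((σ ^ 2 : ℝ) : ℂ) • 1)) (hgn : IndepFun g n P) {C : Matrix ι ι ℂ}
    (hC : C = ((a ^ 2 : ℝ) : ℂ) • (R * (((a ^ 2 : ℝ) : ℂ) • R + ((σ ^ 2 : ℝ) : ℂ) • 1)⁻¹ * R)) :
    ∃ f : EuclideanSpace ℂ ι → EuclideanSpace ℂ ι, Measurable f ∧
      IsCN P (fun ω => f ((a : ℂ) • g ω + n ω)) μ C ∧ C.PosSemidef ∧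
      IsCN P (fun ω => g ω - f ((a : ℂ) • g ω + n ω)) 0 (R - C) ∧ (R - C).PosSemidef ∧
      IndepFun (fun ω => (a : ℂ) • g ω + n ω) (fun ω => g ω - f ((a : ℂ) • g ω + n ω)) P := by
  -- The covariance of the observation, invertible thanks to the noise.
  set Q := ((a ^ 2 : ℝ) : ℂ) • R + ((σ ^ 2 : ℝ) : ℂ) • (1 : Matrix ι ι ℂ) with hQ
  have hQpos : Q.PosDef := by
    have h1 : (((a ^ 2 : ℝ) : ℂ) • R).PosSemidef := hR.smul (by exact_mod_cast sq_nonneg a)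
    have h2 : (((σ ^ 2 : ℝ) : ℂ) • (1 : Matrix ι ι ℂ)).PosDef :=
      Matrix.PosDef.one.smul (by exact_mod_cast pow_pos hσ 2)
    exact h2.posSemidef_add h1
  have hQu : IsUnit Q.det := (Matrix.isUnit_iff_isUnit_det Q).1 hQpos.isUnit
  have hQQ : Q⁻¹ * Q = 1 := Matrix.nonsing_inv_mul Q hQu
  have hRH := hR.isHermitian.eq
  have hQiH : Q⁻¹.conjTranspose = Q⁻¹ := by
    rw [Matrix.conjTranspose_nonsing_inv, hQpos.isHermitian.eq]
  set N := ((σ ^ 2 : ℝ) : ℂ) • (1 : Matrix ι ι ℂ) with hN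
  -- The MMSE gain: cross-covariance `a R` of channel and observation times the inverse covariance
  -- of the observation.
  set A := (a : ℂ) • (R * Q⁻¹) with hA
  have hAH : A.conjTranspose = (a : ℂ) • (Q⁻¹ * R) := by
    simp [hA, Matrix.conjTranspose_smul, Matrix.conjTranspose_mul, hRH, hQiH]
  have hAQ : A * Q = (a : ℂ) • R := by
    rw [hA, Matrix.smul_mul, Matrix.mul_assoc, hQQ, Matrix.mul_one]
  have haa : (a : ℂ) * (a : ℂ) = ((a ^ 2 : ℝ) : ℂ) := by push_cast; ring
  have hAR : (a : ℂ) • (A * R) = C := by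
    rw [hA, hC, Matrix.smul_mul, smul_smul, haa]
  have hRA : (a : ℂ) • (R * A.conjTranspose) = C := by
    rw [hAH, hC, Matrix.mul_smul, smul_smul, haa, Matrix.mul_assoc]
  have hAQA : A * Q * A.conjTranspose = C := by
    rw [hAQ, Matrix.smul_mul, hRA]
  have hNps : N.PosSemidef := posSemidef_sq_smul_one σ
  have hZ := hg.stack hn hR hNps hgn
  have hBps := posSemidef_fromBlocks_diag hR hNps
  -- Observation and estimation error (up to a constant) as linear images of the stacked vector `(g,
  -- n)`; the error is `(1 - aA) g - A n`.
  let By := Matrix.fromCols ((a : ℂ) • (1 : Matrix ι ι ℂ)) (1 : Matrix ι ι ℂ)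
  let Be := Matrix.fromCols (1 - (a : ℂ) • A) (-A)
  have hmul : ∀ x y : EuclideanSpace ℂ ι,
      mulVecE By (WithLp.toLp 2 (Sum.elim x.ofLp y.ofLp)) = (a : ℂ) • x + y := by
    intro x y
    rw [mulVecE_fromCols]
    simp [mulVecE, Matrix.smul_mulVec]
  have hmule : ∀ x y : EuclideanSpace ℂ ι,
      mulVecE Be (WithLp.toLp 2 (Sum.elim x.ofLp y.ofLp)) = x - mulVecE A ((a : ℂ) • x + y) := by
    intro x y
    rw [mulVecE_fromCols]
    ext i
    simp [mulVecE, Matrix.smul_mulVec, Matrix.sub_mulVec, Matrix.neg_mulVec, Matrix.mulVec_add,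
      Matrix.mulVec_smul]
    ring
  have hcovy : By * Matrix.fromBlocks R 0 0 N * By.conjTranspose = Q := by
    rw [fromCols_mul_fromBlocks_mul_conjTranspose]
    simp [-Complex.coe_smul, Matrix.conjTranspose_smul, smul_smul, hQ]
    module
  -- Orthogonality principle: the cross-covariance is `a R - Q Aᴴ`, which is zero by the choice of
  -- `A`.
  have hcross : By * Matrix.fromBlocks R 0 0 N * Be.conjTranspose = 0 := by
    rw [fromCols_mul_fromBlocks_mul_conjTranspose]
    have h1 : Q * A.conjTranspose = (a : ℂ) • R := by
      have := congrArg Matrix.conjTranspose hAQ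
      simpa [Matrix.conjTranspose_mul, Matrix.conjTranspose_smul, hRH,
        hQpos.isHermitian.eq] using this
    have h2 : (a : ℂ) • R * (1 - (a : ℂ) • A).conjTranspose + N * (-A).conjTranspose
        = (a : ℂ) • R - Q * A.conjTranspose := by
      simp [-Complex.coe_smul, hQ, Matrix.conjTranspose_smul, mul_sub, add_mul]
      module
    rw [Matrix.smul_mul, Matrix.one_mul, Matrix.one_mul, h2, h1, sub_self]
  -- The two mixed terms and `A Q Aᴴ` all equal `C`, leaving `R - 2C + C`.
  have hcove : Be * Matrix.fromBlocks R 0 0 N * Be.conjTranspose = R - C := by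
    rw [fromCols_mul_fromBlocks_mul_conjTranspose]
    have h2 : (1 - (a : ℂ) • A) * R * (1 - (a : ℂ) • A).conjTranspose + (-A) * N * (-A).conjTranspose
        = R - (a : ℂ) • (A * R) - (a : ℂ) • (R * A.conjTranspose) + A * Q * A.conjTranspose := by
      simp [-Complex.coe_smul, hQ, Matrix.conjTranspose_smul, mul_sub, sub_mul, mul_add, add_mul,
        Matrix.mul_assoc]
      module
    rw [h2, hAR, hRA, hAQA]
    abel
  have hy := hZ.affine By 0
  have he := hZ.affine Be (mulVecE A ((a : ℂ) • μ) - μ)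
  have hind := hZ.indepFun_mulVecE hBps By Be hcross
  simp only [hmul, hmule, hcovy, hcove, add_zero] at hy he hind
  have hghat := hy.affine A (μ - mulVecE A ((a : ℂ) • μ))
  rw [hAQA] at hghat
  have hCps : C.PosSemidef := hAQA ▸ hQpos.posSemidef.mul_mul_conjTranspose_same A
  -- The constant term gives the estimate mean `μ` and the error mean `0`.
  refine ⟨fun y => mulVecE A y + (μ - mulVecE A ((a : ℂ) • μ)), by fun_prop,
    hghat.congr_cov (by abel) rfl, hCps, ?_,
    hcove ▸ hBps.mul_mul_conjTranspose_same Be, ?_⟩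
  · have h1 := he.congr_cov (μ' := 0) (by abel) rfl
    have h2 : (fun ω => g ω - (mulVecE A ((a : ℂ) • g ω + n ω) + (μ - mulVecE A ((a : ℂ) • μ))))
        = fun ω => g ω - mulVecE A ((a : ℂ) • g ω + n ω) + (mulVecE A ((a : ℂ) • μ) - μ) := by
      ext ω : 1
      abel
    rw [h2]
    exact h1
  · have h1 := hind.comp (φ := id) (ψ := fun x => x - (μ - mulVecE A ((a : ℂ) • μ)))
      measurable_id (by fun_prop)
    convert! h1 using 1
    ext ω : 1
    simp only [Function.comp_apply]
    abel

/-- If `g = f(y) + e` with `e` of mean zero independent of `y`, then `E{g | y} = f(y)`. -/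
lemma condExp_comap_eq_of_indepFun_sub {Ω E F : Type*} [MeasurableSpace Ω] {P : Measure Ω}
    [IsProbabilityMeasure P] [NormedAddCommGroup E] [NormedSpace ℝ E] [CompleteSpace E]
    [MeasurableSpace E] [BorelSpace E] [SecondCountableTopology E] [MeasurableSpace F]
    {g : Ω → E} {y : Ω → F} {f : F → E} (hg : Integrable g P) (hgm : Measurable g)
    (hf : Measurable f)
    (hy : Measurable y) (hfy : Integrable (fun ω => f (y ω)) P)
    (h0 : ∫ ω, (g ω - f (y ω)) ∂P = 0)
    (hind : IndepFun y (fun ω => g ω - f (y ω)) P) :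
    P[g | MeasurableSpace.comap y inferInstance] =ᵐ[P] fun ω => f (y ω) := by
  have hm : MeasurableSpace.comap y inferInstance ≤ (inferInstance : MeasurableSpace Ω) :=
    hy.comap_le
  have hem : Measurable fun ω => g ω - f (y ω) := hgm.sub (hf.comp hy)
  have h1 := condExp_add (μ := P) (m := MeasurableSpace.comap y inferInstance) hfy (hg.sub hfy)
  have h2 : P[fun ω => g ω - f (y ω) | MeasurableSpace.comap y inferInstance] =ᵐ[P] fun _ => 0 := by
    rw [← h0]
    exact condExp_indep_eq hem.comap_le hm
      (comap_measurable fun ω => g ω - f (y ω)).stronglyMeasurable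
      ((IndepFun_iff_Indep _ _ _).1 hind.symm)
  have h3 : P[fun ω => f (y ω) | MeasurableSpace.comap y inferInstance] = fun ω => f (y ω) :=
    condExp_of_stronglyMeasurable hm (hf.comp (comap_measurable y)).stronglyMeasurable hfy
  have h4 : ((fun ω => f (y ω)) + (g - fun ω => f (y ω))) = g := by abel
  rw [h4] at h1
  filter_upwards [h1, h2] with ω h1 h2
  rw [h1, Pi.add_apply, h3]
  change _ + (P[fun ω => g ω - f (y ω) | MeasurableSpace.comap y inferInstance]) ω = _
  rw [h2, add_zero]

lemma IsCN.integrable {Ω : Type*} [MeasurableSpace Ω] {P : Measure Ω} {ι : Type*} [Fintype ι]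
    {X : Ω → EuclideanSpace ℂ ι} {μ : EuclideanSpace ℂ ι} {R : Matrix ι ι ℂ}
    (h : IsCN P X μ R) : Integrable X P :=
  Integrable.of_eval_piLp fun i => (h.hasAllMoments_apply i).integrable

lemma IsCN.integral_eq {Ω : Type*} [MeasurableSpace Ω] {P : Measure Ω} {ι : Type*} [Fintype ι]
    {X : Ω → EuclideanSpace ℂ ι} {μ : EuclideanSpace ℂ ι} {R : Matrix ι ι ℂ}
    (h : IsCN P X μ R) : ∫ ω, X ω ∂P = μ := by
  ext i
  rw [eval_integral_piLp fun i => (h.hasAllMoments_apply i).integrable, h.integral_apply]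

/-- Moments of the combined signals `ĝₖᴴ g_{k'}` and `ĝₖᴴ w` for the MMSE estimate `ĝₖ = f(y)` of
the channel `gₖ` from the observation `y = a gₖ + n`. -/
theorem exists_mmse_estimator_moments {Ω : Type*} [MeasurableSpace Ω] {P : Measure Ω}
    [IsProbabilityMeasure P] {ι κ : Type*} [Fintype ι] [DecidableEq ι]
    {g : κ → Ω → EuclideanSpace ℂ ι} {n w : Ω → EuclideanSpace ℂ ι}
    {μ : κ → EuclideanSpace ℂ ι} {R : κ → Matrix ι ι ℂ} {σ : ℝ} (a : ℝ) (hσ : 0 < σ)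
    (hg : ∀ k, IsCN P (g k) (μ k) (R k)) (hR : ∀ k, (R k).PosSemidef)
    (hn : IsCN P n 0 (((σ ^ 2 : ℝ) : ℂ) • 1)) (hw : IsCN P w 0 (((σ ^ 2 : ℝ) : ℂ) • 1)) (k : κ)
    (hgn : IndepFun (g k) n P)
    (hyg : ∀ k' ≠ k, IndepFun (fun ω => (a : ℂ) • g k ω + n ω) (g k') P)
    (hyw : IndepFun (fun ω => (a : ℂ) • g k ω + n ω) w P) {C : Matrix ι ι ℂ}
    (hC : C = ((a ^ 2 : ℝ) : ℂ) •
      (R k * (((a ^ 2 : ℝ) : ℂ) • R k + ((σ ^ 2 : ℝ) : ℂ) • 1)⁻¹ * R k)) :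
    ∃ f : EuclideanSpace ℂ ι → EuclideanSpace ℂ ι, Measurable f ∧
      IsCN P (fun ω => f ((a : ℂ) • g k ω + n ω)) (μ k) C ∧
      IsCN P (fun ω => g k ω - f ((a : ℂ) • g k ω + n ω)) 0 (R k - C) ∧
      IndepFun (fun ω => (a : ℂ) • g k ω + n ω)
        (fun ω => g k ω - f ((a : ℂ) • g k ω + n ω)) P ∧
      ∫ ω, inner ℂ (f ((a : ℂ) • g k ω + n ω)) (g k ω) ∂P
        = ((‖μ k‖ ^ 2 + C.trace.re : ℝ) : ℂ) ∧
      (∀ k' ≠ k, ∫ ω, inner ℂ (f ((a : ℂ) • g k ω + n ω)) (g k' ω) ∂P = inner ℂ (μ k) (μ k')) ∧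
      (∀ k', ∫ ω, ‖inner ℂ (f ((a : ℂ) • g k ω + n ω)) (g k' ω)‖ ^ 2 ∂P
        = ‖∫ ω, inner ℂ (f ((a : ℂ) • g k ω + n ω)) (g k' ω) ∂P‖ ^ 2
          + ((sesqForm C (μ k') (μ k')).re + (sesqForm (R k') (μ k) (μ k)).re
            + (R k' * C).trace.re)) ∧
      ∫ ω, ‖inner ℂ (f ((a : ℂ) • g k ω + n ω)) (w ω)‖ ^ 2 ∂P
        = σ ^ 2 * (‖μ k‖ ^ 2 + C.trace.re) := by
  obtain ⟨f, hf, hest, hCps, herr, hDps, hind⟩ :=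
    exists_mmse_estimator a hσ (hg k) (hR k) hn hgn hC
  have hfe : IndepFun (fun ω => f ((a : ℂ) • g k ω + n ω))
      (fun ω => g k ω - f ((a : ℂ) • g k ω + n ω)) P := hind.comp hf measurable_id
  have hfg : ∀ k' ≠ k, IndepFun (fun ω => f ((a : ℂ) • g k ω + n ω)) (g k') P :=
    fun k' hk' => (hyg k' hk').comp hf measurable_id
  have hmean := hest.integral_inner_add_self herr hCps hfe
  simp only [add_sub_cancel] at hmean
  have hmeans : ∀ k' ≠ k, ∫ ω, inner ℂ (f ((a : ℂ) • g k ω + n ω)) (g k' ω) ∂P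
      = inner ℂ (μ k) (μ k') :=
    fun k' hk' => hest.integral_inner (hg k') (hfg k' hk')
  refine ⟨f, hf, hest, herr, hind, hmean, hmeans, fun k' => ?_, ?_⟩
  -- For `k' = k` the channel is estimate plus independent error, with covariances `C + (R - C) =
  -- R`. For `k' ≠ k` the channel is independent of the estimate. The excess over the squared mean
  -- is the same.
  · by_cases hk : k' = k
    · subst hk
      have h1 := hest.integral_norm_inner_add_self_sq herr hCps hDps hfe
      simp only [add_sub_cancel] at h1
      rw [h1, hmean, Complex.norm_real, Real.norm_eq_abs, sq_abs]
      ring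
    · rw [hmeans k' hk, hest.integral_norm_inner_sq (hg k') hCps (hR k') (hfg k' hk)]
      ring
  · rw [hest.integral_norm_inner_sq hw hCps (posSemidef_sq_smul_one σ)
      (hyw.comp hf measurable_id)]
    have e1 : sesqForm (((σ ^ 2 : ℝ) : ℂ) • (1 : Matrix ι ι ℂ)) (μ k) (μ k)
        = ((σ ^ 2 * ‖μ k‖ ^ 2 : ℝ) : ℂ) := by
      have := inner_self_eq_norm_sq_to_K (𝕜 := ℂ) (μ k)
      rw [EuclideanSpace.inner_eq_star_dotProduct] at this
      rw [sesqForm, Matrix.smul_mulVec, Matrix.one_mulVec, dotProduct_smul, dotProduct_comm, this]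
      simp
    rw [e1, Complex.ofReal_re, Matrix.smul_mul, Matrix.one_mul, Matrix.trace_smul, smul_eq_mul,
      Complex.re_ofReal_mul, inner_zero_right]
    simp [sesqForm]
    ring

/-- The variance of a sum of pairwise independent complex random variables. -/
lemma integral_norm_sum_sq_of_pairwise_indepFun {Ω : Type*} [MeasurableSpace Ω] {P : Measure Ω}
    {ι : Type*} [Fintype ι] {F : ι → Ω → ℂ} (hF : ∀ i, HasAllMoments P (F i))
    (hind : Pairwise fun i j => IndepFun (F i) (F j) P) :
    ∫ ω, ‖∑ i, F i ω‖ ^ 2 ∂P = ‖∑ i, ∫ ω, F i ω ∂P‖ ^ 2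
      + ∑ i, (∫ ω, ‖F i ω‖ ^ 2 ∂P - ‖∫ ω, F i ω ∂P‖ ^ 2) := by
  classical
  have hexp : ∀ z : ι → ℂ, ((‖∑ i, z i‖ ^ 2 : ℝ) : ℂ) = ∑ i, ∑ j, z i * conj (z j) := by
    intro z
    push_cast
    rw [← Complex.mul_conj', map_sum, Finset.sum_mul_sum]
  have hint := fun i j => ((hF i).mul (hF j).star).integrable
  apply Complex.ofReal_injective
  rw [Complex.ofReal_add, hexp, ← integral_complex_ofReal]
  simp only [hexp]
  rw [integral_finsetSum _ fun i _ => integrable_finsetSum _ fun j _ => hint i j]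
  simp_rw [integral_finsetSum _ fun j _ => hint _ j]
  rw [Complex.ofReal_sum, ← Finset.sum_add_distrib]
  refine Finset.sum_congr rfl fun i _ => ?_
  -- Off-diagonal terms factor as in the squared mean; the diagonal one is `E|F i|²` in place of `|E
  -- F i|²`.
  rw [← Finset.sum_erase_add _ _ (Finset.mem_univ i),
    ← Finset.sum_erase_add Finset.univ (fun j => (∫ ω, F i ω ∂P) * _) (Finset.mem_univ i), add_assoc]
  congr 1
  · refine Finset.sum_congr rfl fun j hj => ?_
    have h1 : IndepFun (F i) (fun ω => conj (F j ω)) P :=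
      (hind (Finset.ne_of_mem_erase hj).symm).comp (φ := id) (ψ := fun z : ℂ => conj z)
        measurable_id (by fun_prop)
    rw [h1.integral_fun_mul_eq_mul_integral (hF i 1).aestronglyMeasurable
      ((hF j).star 1).aestronglyMeasurable, integral_conj]
  · rw [Complex.ofReal_sub, ← integral_complex_ofReal]
    simp [Complex.mul_conj']

/-! ### Despreading with orthonormal pilots. -/

section Despreading

variable {Ω : Type*} {K M N : ℕ}

/-- The matrix of the linear map `W ↦ W φ` on `N × K` matrices. -/
def despreadMatrix (N : ℕ) {K : ℕ} (φ : EuclideanSpace ℂ (Fin K)) :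
    Matrix (Fin N) (Fin N × Fin K) ℂ :=
  Matrix.of fun n q => if n = q.1 then φ q.2 else 0

/-- The rows are orthonormal, so despread white noise stays white with the same variance. -/
lemma despreadMatrix_mul_conjTranspose (φ : EuclideanSpace ℂ (Fin K)) (hφ : ‖φ‖ = 1) :
    despreadMatrix N φ * (despreadMatrix N φ).conjTranspose = 1 := by
  ext i j
  have h1 : ∑ q, φ q * conj (φ q) = 1 := by
    rw [← inner_eq_sum, inner_self_eq_norm_sq_to_K, hφ]
    simp
  simp only [Matrix.mul_apply, despreadMatrix, Matrix.conjTranspose_apply, Matrix.of_apply,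
    Fintype.sum_prod_type]
  by_cases hij : i = j
  · subst hij
    rw [Finset.sum_eq_single i (fun b _ hb => by simp [hb.symm]) (by simp)]
    simpa using h1
  · rw [Matrix.one_apply_ne hij]
    refine Finset.sum_eq_zero fun x _ => Finset.sum_eq_zero fun y _ => ?_
    by_cases hx : i = x
    · simp [← hx, Ne.symm hij]
    · simp [hx]

lemma satObs_eq (S : Setup K M N) (X : Signals Ω K M N) (k : Fin K) (ω : Ω) :
    satObs S X k ω = (Real.sqrt (S.p * K) : ℂ) • X.g k ω
      + mulVecE (despreadMatrix N (S.φ k)) (X.Wp ω) := by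
  have h1 : ∀ k', star (S.φ k').ofLp ⬝ᵥ (S.φ k).ofLp = if k' = k then 1 else 0 := by
    intro k'
    rw [dotProduct_comm, ← EuclideanSpace.inner_eq_star_dotProduct]
    exact orthonormal_iff_ite.1 S.φ_orthonormal k' k
  have h2 : ∀ k', ((Real.sqrt (S.p * K) : ℂ) •
        Matrix.vecMulVec (X.g k' ω).ofLp (star (S.φ k').ofLp)).mulVec (S.φ k).ofLp
      = if k' = k then (Real.sqrt (S.p * K) : ℂ) • (X.g k' ω).ofLp else 0 := by
    intro k'
    rw [Matrix.smul_mulVec, Matrix.vecMulVec_mulVec, h1]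
    split_ifs <;> simp
  ext i
  simp only [satObs, satPilot, Matrix.add_mulVec, Matrix.sum_mulVec, h2, Finset.sum_ite_eq',
    Finset.mem_univ, if_true, PiLp.add_apply, PiLp.smul_apply, Pi.add_apply, Pi.smul_apply]
  congr 1
  simp only [mulVecE, Matrix.mulVec, dotProduct, despreadMatrix, Matrix.of_apply,
    Fintype.sum_prod_type]
  rw [Finset.sum_eq_single i (fun b _ hb => by simp [hb.symm]) (by simp)]
  simp [mul_comm]

lemma apObs_eq (S : Setup K M N) (X : Signals Ω K M N) (m : Fin M) (k : Fin K) (ω : Ω) :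
    apObs S X m k ω = (Real.sqrt (S.p * K) : ℂ) * X.gAP m k ω + inner ℂ (X.wp m ω) (S.φ k) := by
  rw [apObs, apPilot, inner_add_left, sum_inner]
  simp [inner_smul_left, orthonormal_iff_ite.1 S.φ_orthonormal]

end Despreading

/-! ### Scalars as one-dimensional vectors. -/

/-- A complex number as a vector with a single coordinate. -/
noncomputable def scalarVec (z : ℂ) : EuclideanSpace ℂ Unit := WithLp.toLp 2 fun _ => z

@[simp]
lemma scalarVec_apply (z : ℂ) (i : Unit) : scalarVec z i = z := rfl

@[fun_prop]
lemma measurable_scalarVec : Measurable scalarVec := by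
  unfold scalarVec
  fun_prop

lemma inner_scalarVec (z : ℂ) (x : EuclideanSpace ℂ Unit) :
    inner ℂ x (scalarVec z) = conj (x ()) * z := by
  simp [inner_eq_sum, mul_comm]

/-- Makes AP estimation an instance of the vector result over `Unit`. -/
lemma IsScalarCN.isCN {Ω : Type*} [MeasurableSpace Ω] {P : Measure Ω} {x : Ω → ℂ} {μ : ℂ} {v : ℝ}
    (h : IsScalarCN P x μ v) :
    IsCN P (fun ω => scalarVec (x ω)) (scalarVec μ) ((v : ℂ) • 1) where
  measurable := measurable_scalarVec.comp h.measurable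
  map_re_inner t := by
    have h1 := h.map_re_mul (t ())
    simp only [inner_scalarVec]
    rw [h1]
    congr 2
    simp only [dotProduct, Matrix.smul_mulVec, Matrix.one_mulVec, Finset.univ_unique,
      Finset.sum_singleton, Pi.star_apply, Pi.smul_apply, smul_eq_mul, RCLike.star_def]
    rw [mul_left_comm, Complex.conj_mul', Complex.re_ofReal_mul, ← Complex.ofReal_pow,
      Complex.ofReal_re, mul_comm]

/-- The noise in a despread AP observation. It is antilinear in `X`, which is harmless: conjugation
preserves real parts, so the test scalar moves onto `φ`. -/
lemma IsCN.isScalarCN_inner {Ω : Type*} [MeasurableSpace Ω] {P : Measure Ω} {ι : Type*} [Fintype ι]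
    [DecidableEq ι] {X : Ω → EuclideanSpace ℂ ι} {v : ℝ} (h : IsCN P X 0 ((v : ℂ) • 1))
    {φ : EuclideanSpace ℂ ι} (hφ : ‖φ‖ = 1) :
    IsScalarCN P (fun ω => inner ℂ (X ω) φ) 0 v where
  measurable := by
    have := h.measurable
    fun_prop
  map_re_mul t := by
    have h1 := h.map_re_inner (conj t • φ)
    have h2 : ∀ ω, (conj t * inner ℂ (X ω) φ).re = (inner ℂ (conj t • φ) (X ω)).re := by
      intro ω
      rw [inner_smul_left, ← inner_conj_symm (X ω) φ, ← map_mul, Complex.conj_re,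
        Complex.conj_conj]
    simp only [h2]
    rw [h1]
    congr 2
    · simp
    · have h3 := inner_self_eq_norm_sq_to_K (𝕜 := ℂ) (conj t • φ)
      rw [EuclideanSpace.inner_eq_star_dotProduct, norm_smul, hφ] at h3
      rw [Matrix.smul_mulVec, Matrix.one_mulVec, dotProduct_smul, dotProduct_comm, h3]
      simp [← Complex.ofReal_pow, mul_comm]

/-! ### Independence and measurability in terms of sources. -/

namespace Signals

variable {Ω : Type*} {K M N : ℕ}

lemma measurable_of_mem (X : Signals Ω K M N) {A : Set (Source K M)} {s : Source K M} (hs : s ∈ A)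
    {E : Type*} [MeasurableSpace E] {f : Ω → E} (hf : Measurable[X.sigma s] f) :
    Measurable[⨆ s ∈ A, X.sigma s] f :=
  hf.mono (le_iSup₂ (f := fun s (_ : s ∈ A) => X.sigma s) s hs) le_rfl

namespace HasModel

variable [MeasurableSpace Ω] {P : Measure Ω} {S : Setup K M N} {X : Signals Ω K M N}

lemma sigma_le (hX : X.HasModel P S) (s : Source K M) :
    X.sigma s ≤ (inferInstance : MeasurableSpace Ω) := by
  cases s with
  | satChannel k => exact (hX.g_law k).measurable.comap_le
  | apChannel m k => exact (hX.gAP_law m k).measurable.comap_le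
  | satPilotNoise => exact hX.Wp_law.measurable.comap_le
  | apPilotNoise m => exact (hX.wp_law m).measurable.comap_le
  | satNoise => exact hX.w_law.measurable.comap_le
  | apNoise m => exact (hX.wAP_law m).measurable.comap_le

lemma indepFun_of_disjoint (hX : X.HasModel P S) {A B : Set (Source K M)} (hAB : Disjoint A B)
    {E F : Type*} [MeasurableSpace E] [MeasurableSpace F] {f : Ω → E} {g : Ω → F}
    (hf : Measurable[⨆ s ∈ A, X.sigma s] f) (hg : Measurable[⨆ s ∈ B, X.sigma s] g) :
    IndepFun f g P :=
  (IndepFun_iff_Indep _ _ _).2 <|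
    indep_of_indep_of_le (indep_iSup_of_disjoint hX.sigma_le hX.indep hAB)
      hf.comap_le hg.comap_le

end HasModel

end Signals

/-- Kept general in the σ-algebra on `Ω`, for use with the one generated by a set of sources. -/
lemma measurable_smul_add_mulVecE {Ω ι κ : Type*} [MeasurableSpace Ω] [Fintype ι] [Fintype κ]
    (c : ℂ) (A : Matrix ι κ ℂ) {x : Ω → EuclideanSpace ℂ ι} {y : Ω → EuclideanSpace ℂ κ}
    (hx : Measurable x) (hy : Measurable y) : Measurable fun ω => c • x ω + mulVecE A (y ω) := by
  fun_prop

lemma measurable_mul_add_inner {Ω ι : Type*} [MeasurableSpace Ω] [Fintype ι] (c : ℂ)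
    (φ : EuclideanSpace ℂ ι) {x : Ω → ℂ} {y : Ω → EuclideanSpace ℂ ι}
    (hx : Measurable x) (hy : Measurable y) : Measurable fun ω => c * x ω + inner ℂ (y ω) φ := by
  fun_prop

section ObservationMeasurability

variable {Ω : Type*} {K M N : ℕ} {S : Setup K M N} {X : Signals Ω K M N}

lemma measurable_satObs {A : Set (Source K M)} {k : Fin K} (h1 : Source.satChannel k ∈ A)
    (h2 : Source.satPilotNoise ∈ A) : Measurable[⨆ s ∈ A, X.sigma s] (satObs S X k) := by
  rw [funext (satObs_eq S X k)]
  exact @measurable_smul_add_mulVecE Ω _ _ (⨆ s ∈ A, X.sigma s) _ _ _ _ _ _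
    (X.measurable_of_mem h1 (comap_measurable _)) (X.measurable_of_mem h2 (comap_measurable _))

lemma measurable_apObs {A : Set (Source K M)} {m : Fin M} {k : Fin K}
    (h1 : Source.apChannel m k ∈ A) (h2 : Source.apPilotNoise m ∈ A) :
    Measurable[⨆ s ∈ A, X.sigma s] (apObs S X m k) := by
  rw [funext (apObs_eq S X m k)]
  exact @measurable_mul_add_inner Ω _ (⨆ s ∈ A, X.sigma s) _ _ _ _ _
    (X.measurable_of_mem h1 (comap_measurable _)) (X.measurable_of_mem h2 (comap_measurable _))

lemma iSup_sigma_le [MeasurableSpace Ω] {P : Measure Ω} (hX : X.HasModel P S) (A : Set (Source K M)) :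
    ⨆ s ∈ A, X.sigma s ≤ (inferInstance : MeasurableSpace Ω) :=
  iSup₂_le fun s _ => hX.sigma_le s

end ObservationMeasurability

/-! ### The satellite and AP estimates and their moments. -/

section Estimates

variable {Ω : Type*} [MeasurableSpace Ω] {P : Measure Ω} [IsProbabilityMeasure P] {K M N : ℕ}
  {S : Setup K M N} {X : Signals Ω K M N}

/-- The satellite estimate as a function of the observation, and the moments of the satellite part
of the combined signal. -/
theorem exists_satEstimate_moments (hX : X.HasModel P S) (k : Fin K) :
    ∃ f : EuclideanSpace ℂ (Fin N) → EuclideanSpace ℂ (Fin N), Measurable f ∧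
      satEstimate P S X k =ᵐ[P] (fun ω => f (satObs S X k ω)) ∧
      (∀ k', HasAllMoments P fun ω => inner ℂ (f (satObs S X k ω)) (X.g k' ω)) ∧
      HasAllMoments P (fun ω => inner ℂ (f (satObs S X k ω)) (X.w ω)) ∧
      ∫ ω, inner ℂ (f (satObs S X k ω)) (X.g k ω) ∂P
        = ((‖S.gbar k‖ ^ 2 + S.p * K * (S.Θ k).trace.re : ℝ) : ℂ) ∧
      (∀ k' ≠ k, ∫ ω, inner ℂ (f (satObs S X k ω)) (X.g k' ω) ∂P
        = inner ℂ (S.gbar k) (S.gbar k')) ∧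
      (∀ k', ∫ ω, ‖inner ℂ (f (satObs S X k ω)) (X.g k' ω)‖ ^ 2 ∂P
        = ‖∫ ω, inner ℂ (f (satObs S X k ω)) (X.g k' ω) ∂P‖ ^ 2
          + (S.p * K * quadForm (S.Θ k) (S.gbar k') + quadForm (S.R k') (S.gbar k)
            + S.p * K * (S.R k' * S.Θ k).trace.re)) ∧
      ∫ ω, ‖inner ℂ (f (satObs S X k ω)) (X.w ω)‖ ^ 2 ∂P
        = S.σs ^ 2 * (‖S.gbar k‖ ^ 2 + S.p * K * (S.Θ k).trace.re) := by
  have hpK : Real.sqrt (S.p * K) ^ 2 = S.p * K :=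
    Real.sq_sqrt (mul_nonneg S.p_nonneg (Nat.cast_nonneg K))
  let n : Ω → EuclideanSpace ℂ (Fin N) := fun ω => mulVecE (despreadMatrix N (S.φ k)) (X.Wp ω)
  have hn : IsCN P n 0 (((S.σs ^ 2 : ℝ) : ℂ) • 1) := by
    have h1 := hX.Wp_law.affine (despreadMatrix N (S.φ k)) 0
    simp only [add_zero] at h1
    refine h1.congr_cov (by simp [mulVecE]) ?_
    rw [Matrix.mul_smul, Matrix.mul_one, Matrix.smul_mul,
      despreadMatrix_mul_conjTranspose _ (S.φ_orthonormal.1 k)]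
  have hobs : ∀ ω, satObs S X k ω = (Real.sqrt (S.p * K) : ℂ) • X.g k ω + n ω := satObs_eq S X k
  -- The sources on which the despread observation depends; other users' channels and the data noise
  -- lie outside.
  let A : Set (Source K M) := {Source.satChannel k, Source.satPilotNoise}
  have hyA : Measurable[⨆ s ∈ A, X.sigma s] (satObs S X k) :=
    measurable_satObs (by simp [A]) (by simp [A])
  have hym : Measurable (satObs S X k) := hyA.mono (iSup_sigma_le hX A) le_rfl
  have hgn : IndepFun (X.g k) n P := by
    have h1 : IndepFun (X.g k) X.Wp P :=
      hX.indepFun_of_disjoint (A := {Source.satChannel k}) (B := {Source.satPilotNoise})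
        (by simp)
        (X.measurable_of_mem (Set.mem_singleton _) (comap_measurable _))
        (X.measurable_of_mem (Set.mem_singleton _) (comap_measurable _))
    exact h1.comp measurable_id (measurable_mulVecE _)
  have hyg : ∀ k' ≠ k, IndepFun (satObs S X k) (X.g k') P := fun k' hk' =>
    hX.indepFun_of_disjoint (B := {Source.satChannel k'}) (by simp [A, hk']) hyA
      (X.measurable_of_mem (Set.mem_singleton _) (comap_measurable _))
  have hyw : IndepFun (satObs S X k) X.w P :=
    hX.indepFun_of_disjoint (B := {Source.satNoise}) (by simp [A]) hyA
      (X.measurable_of_mem (Set.mem_singleton _) (comap_measurable _))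
  obtain ⟨f, hf, hest, herr, hind, hmean, hmeans, hsq, hnoise⟩ :=
    exists_mmse_estimator_moments (C := ((S.p * K : ℝ) : ℂ) • S.Θ k) (Real.sqrt (S.p * K))
      S.σs_pos hX.g_law S.R_posSemidef hn hX.w_law k hgn
      (by simpa only [← hobs] using hyg) (by simpa only [← hobs] using hyw)
      (by rw [hpK]; rfl)
  simp only [← hobs] at hest herr hind hmean hmeans hsq hnoise
  have htr : (((S.p * K : ℝ) : ℂ) • S.Θ k).trace.re = S.p * K * (S.Θ k).trace.re := by
    rw [Matrix.trace_smul, smul_eq_mul, Complex.re_ofReal_mul]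
  refine ⟨f, hf, ?_, fun k' => hest.hasAllMoments_inner (hX.g_law k'),
    hest.hasAllMoments_inner hX.w_law, by rw [hmean, htr], hmeans, fun k' => ?_,
    by rw [hnoise, htr]⟩
  · refine condExp_comap_eq_of_indepFun_sub (hX.g_law k).integrable (hX.g_law k).measurable hf hym
      hest.integrable herr.integral_eq hind
  · rw [hsq k']
    have e1 : (sesqForm (((S.p * K : ℝ) : ℂ) • S.Θ k) (S.gbar k') (S.gbar k')).re
        = S.p * K * quadForm (S.Θ k) (S.gbar k') := by
      rw [sesqForm, Matrix.smul_mulVec, dotProduct_smul, smul_eq_mul, Complex.re_ofReal_mul,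
        quadForm]
    rw [e1, Matrix.mul_smul, Matrix.trace_smul, smul_eq_mul, Complex.re_ofReal_mul]
    rfl

/-- The AP estimate as a function of the observation, and the moments of the contribution of the AP
to the combined signal. -/
theorem exists_apEstimate_moments (hX : X.HasModel P S) (m : Fin M) (k : Fin K) :
    ∃ f : ℂ → ℂ, Measurable f ∧
      apEstimate P S X m k =ᵐ[P] (fun ω => f (apObs S X m k ω)) ∧
      (∀ k', HasAllMoments P fun ω => conj (f (apObs S X m k ω)) * X.gAP m k' ω) ∧
      HasAllMoments P (fun ω => conj (f (apObs S X m k ω)) * X.wAP m ω) ∧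
      ∫ ω, conj (f (apObs S X m k ω)) * X.gAP m k ω ∂P = (S.γ m k : ℂ) ∧
      (∀ k' ≠ k, ∫ ω, conj (f (apObs S X m k ω)) * X.gAP m k' ω ∂P = 0) ∧
      (∀ k', ∫ ω, ‖conj (f (apObs S X m k ω)) * X.gAP m k' ω‖ ^ 2 ∂P
        = ‖∫ ω, conj (f (apObs S X m k ω)) * X.gAP m k' ω ∂P‖ ^ 2 + S.γ m k * S.β m k') ∧
      ∫ ω, ‖conj (f (apObs S X m k ω)) * X.wAP m ω‖ ^ 2 ∂P = S.σa ^ 2 * S.γ m k := by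
  have hpK0 : 0 ≤ S.p * K := mul_nonneg S.p_nonneg (Nat.cast_nonneg K)
  have hpK : Real.sqrt (S.p * K) ^ 2 = S.p * K := Real.sq_sqrt hpK0
  have hn0 := ((hX.wp_law m).isScalarCN_inner (S.φ_orthonormal.1 k))
  let n : Ω → EuclideanSpace ℂ Unit := fun ω => scalarVec (inner ℂ (X.wp m ω) (S.φ k))
  have hzero : scalarVec 0 = 0 := rfl
  have hn : IsCN P n 0 (((S.σa ^ 2 : ℝ) : ℂ) • 1) := hn0.isCN
  have hobs : ∀ ω, (Real.sqrt (S.p * K) : ℂ) • scalarVec (X.gAP m k ω) + n ω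
      = scalarVec (apObs S X m k ω) := by
    intro ω
    rw [apObs_eq]
    rfl
  let A : Set (Source K M) := {Source.apChannel m k, Source.apPilotNoise m}
  have hyA : Measurable[⨆ s ∈ A, X.sigma s] (apObs S X m k) :=
    measurable_apObs (by simp [A]) (by simp [A])
  have hym : Measurable (apObs S X m k) := hyA.mono (iSup_sigma_le hX A) le_rfl
  have hgn : IndepFun (fun ω => scalarVec (X.gAP m k ω)) n P := by
    have h1 : IndepFun (X.gAP m k) (X.wp m) P :=
      hX.indepFun_of_disjoint (A := {Source.apChannel m k}) (B := {Source.apPilotNoise m})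
        (by simp)
        (X.measurable_of_mem (Set.mem_singleton _) (comap_measurable _))
        (X.measurable_of_mem (Set.mem_singleton _) (comap_measurable _))
    exact h1.comp (φ := scalarVec) (ψ := fun v => scalarVec (inner ℂ v (S.φ k)))
      (by fun_prop) (by fun_prop)
  have hyg : ∀ k' ≠ k, IndepFun (fun ω => scalarVec (apObs S X m k ω))
      (fun ω => scalarVec (X.gAP m k' ω)) P := by
    intro k' hk'
    have h1 : IndepFun (apObs S X m k) (X.gAP m k') P :=
      hX.indepFun_of_disjoint (B := {Source.apChannel m k'}) (by simp [A, hk']) hyA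
        (X.measurable_of_mem (Set.mem_singleton _) (comap_measurable _))
    exact h1.comp measurable_scalarVec measurable_scalarVec
  have hyw : IndepFun (fun ω => scalarVec (apObs S X m k ω))
      (fun ω => scalarVec (X.wAP m ω)) P := by
    have h1 : IndepFun (apObs S X m k) (X.wAP m) P :=
      hX.indepFun_of_disjoint (B := {Source.apNoise m}) (by simp [A]) hyA
        (X.measurable_of_mem (Set.mem_singleton _) (comap_measurable _))
    exact h1.comp measurable_scalarVec measurable_scalarVec
  have hR : ∀ k', ((S.β m k' : ℂ) • (1 : Matrix Unit Unit ℂ)).PosSemidef := fun k' =>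
    Matrix.PosSemidef.one.smul (by exact_mod_cast S.β_nonneg m k')
  have hden : S.p * K * S.β m k + S.σa ^ 2 ≠ 0 :=
    (add_pos_of_nonneg_of_pos (mul_nonneg hpK0 (S.β_nonneg m k)) (pow_pos S.σa_pos 2)).ne'
  -- For `1 × 1` matrices, `C` is `pK β (pK β + σ_a²)⁻¹ β = γ`.
  have hC : (S.γ m k : ℂ) • (1 : Matrix Unit Unit ℂ)
      = ((Real.sqrt (S.p * K) ^ 2 : ℝ) : ℂ) • ((S.β m k : ℂ) • 1 *
        (((Real.sqrt (S.p * K) ^ 2 : ℝ) : ℂ) • (S.β m k : ℂ) • 1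
          + ((S.σa ^ 2 : ℝ) : ℂ) • 1)⁻¹ * (S.β m k : ℂ) • 1) := by
    have h1 : ((Real.sqrt (S.p * K) ^ 2 : ℝ) : ℂ) • (S.β m k : ℂ) • (1 : Matrix Unit Unit ℂ)
          + ((S.σa ^ 2 : ℝ) : ℂ) • 1
        = ((S.p * K * S.β m k + S.σa ^ 2 : ℝ) : ℂ) • 1 := by
      rw [hpK, smul_smul, ← add_smul]
      push_cast
      rfl
    have h2 : (((S.p * K * S.β m k + S.σa ^ 2 : ℝ) : ℂ) • (1 : Matrix Unit Unit ℂ))⁻¹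
        = (((S.p * K * S.β m k + S.σa ^ 2)⁻¹ : ℝ) : ℂ) • 1 := by
      refine Matrix.inv_eq_right_inv ?_
      rw [Matrix.smul_mul, Matrix.mul_smul, smul_smul, Matrix.one_mul, ← Complex.ofReal_mul,
        mul_inv_cancel₀ hden, Complex.ofReal_one, one_smul]
    rw [h1, h2, hpK]
    simp only [Matrix.smul_mul, Matrix.mul_smul, Matrix.one_mul, smul_smul, ← Complex.ofReal_mul]
    congr 2
    rw [Setup.γ]
    field_simp
  obtain ⟨f, hf, hest, herr, hind, hmean, hmeans, hsq, hnoise⟩ :=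
    exists_mmse_estimator_moments (g := fun k' ω => scalarVec (X.gAP m k' ω))
      (w := fun ω => scalarVec (X.wAP m ω)) (Real.sqrt (S.p * K))
      S.σa_pos (fun k' => (hX.gAP_law m k').isCN) hR hn (hX.wAP_law m).isCN k hgn
      (by simpa only [hobs] using hyg) (by simpa only [hobs] using hyw) hC
  simp only [hobs, inner_scalarVec] at hest herr hind hmean hmeans hsq hnoise
  have hallg := fun k' => hest.hasAllMoments_inner (hX.gAP_law m k').isCN
  have hallw := hest.hasAllMoments_inner (hX.wAP_law m).isCN
  simp only [inner_scalarVec] at hallg hallw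
  have htr : ((S.γ m k : ℂ) • (1 : Matrix Unit Unit ℂ)).trace.re = S.γ m k := by simp
  have hf' : Measurable fun z : ℂ => f (scalarVec z) () := by fun_prop
  refine ⟨fun z => f (scalarVec z) (), hf', ?_, hallg, hallw, ?_, fun k' hk' => ?_,
    fun k' => ?_, ?_⟩
  · have hgi := ((hX.gAP_law m k).isCN.hasAllMoments_apply ()).integrable
    have hindc : IndepFun (apObs S X m k)
        (fun ω => X.gAP m k ω - f (scalarVec (apObs S X m k ω)) ()) P :=
      hind.comp (φ := fun v : EuclideanSpace ℂ Unit => v ())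
        (ψ := fun v : EuclideanSpace ℂ Unit => v ()) (by fun_prop) (by fun_prop)
    have h0 := herr.integral_apply ()
    exact condExp_comap_eq_of_indepFun_sub hgi (hX.gAP_law m k).measurable hf' hym
      (hest.hasAllMoments_apply ()).integrable h0 hindc
  · rw [hmean, htr, hzero]
    simp
  · rw [hmeans k' hk', mul_zero]
  · rw [hsq k', hzero]
    simp [sesqForm, mul_comm]
  · rw [hnoise, htr, hzero]
    simp

end Estimates

/-! ### Combining the satellite and the APs. -/

section Combining

variable {Ω : Type*} {K M N : ℕ}

/-- The satellite (`none`) and AP (`some m`) contributions to the overall channel coefficient for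
given functions of the observations of user `k`. -/
noncomputable def coeffPart (S : Setup K M N) (X : Signals Ω K M N) (k : Fin K)
    (f : EuclideanSpace ℂ (Fin N) → EuclideanSpace ℂ (Fin N)) (fAP : Fin M → ℂ → ℂ) (k' : Fin K) :
    Option (Fin M) → Ω → ℂ
  | none => fun ω => inner ℂ (f (satObs S X k ω)) (X.g k' ω)
  | some m => fun ω => conj (fAP m (apObs S X m k ω)) * X.gAP m k' ω

/-- The sources of randomness seen by the satellite (`none`) or by AP `m` (`some m`) before the data
noise is added. -/
def partSources (K : ℕ) {M : ℕ} : Option (Fin M) → Set (Source K M)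
  | none => {s | s = Source.satPilotNoise ∨ ∃ k, s = Source.satChannel k}
  | some m => {s | s = Source.apPilotNoise m ∨ ∃ k, s = Source.apChannel m k}

lemma disjoint_partSources {i j : Option (Fin M)} (hij : i ≠ j) :
    Disjoint (partSources K i) (partSources K j) := by
  rw [Set.disjoint_left]
  rintro s hi hj
  cases i <;> cases j <;> rcases hi with rfl | ⟨k, rfl⟩ <;> rcases hj with h | ⟨k', h⟩ <;> simp_all

lemma measurable_uncurry_comp {E F : Type*} [MeasurableSpace Ω] [MeasurableSpace E]
    [MeasurableSpace F] {y : Ω → E} {x : Ω → F} {h : E × F → ℂ} (hh : Measurable h)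
    (hy : Measurable y) (hx : Measurable x) : Measurable fun ω => h (y ω, x ω) :=
  hh.comp (hy.prodMk hx)

lemma measurable_coeffPart (S : Setup K M N) (X : Signals Ω K M N) (k : Fin K)
    {f : EuclideanSpace ℂ (Fin N) → EuclideanSpace ℂ (Fin N)} {fAP : Fin M → ℂ → ℂ}
    (hf : Measurable f) (hfAP : ∀ m, Measurable (fAP m)) (k' : Fin K) (i : Option (Fin M)) :
    Measurable[⨆ s ∈ partSources K i, X.sigma s] (coeffPart S X k f fAP k' i) := by
  cases i with
  | none =>
    exact @measurable_uncurry_comp Ω _ _ (⨆ s ∈ partSources K none, X.sigma s) _ _ _ _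
      (fun q => inner ℂ (f q.1) q.2) (by fun_prop)
      (measurable_satObs (Or.inr ⟨k, rfl⟩) (Or.inl rfl))
      (X.measurable_of_mem (s := Source.satChannel k') (Or.inr ⟨k', rfl⟩) (comap_measurable _))
  | some m =>
    have := hfAP m
    exact @measurable_uncurry_comp Ω _ _ (⨆ s ∈ partSources K (some m), X.sigma s) _ _ _ _
      (fun q => conj (fAP m q.1) * q.2) (by fun_prop)
      (measurable_apObs (Or.inr ⟨k, rfl⟩) (Or.inl rfl))
      (X.measurable_of_mem (s := Source.apChannel m k') (Or.inr ⟨k', rfl⟩) (comap_measurable _))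

end Combining

/-- Use-and-then-forget moments of maximum ratio combining with MMSE estimates. -/
theorem mrc_moments {Ω : Type*} [MeasurableSpace Ω] {P : Measure Ω} [IsProbabilityMeasure P]
    {K M N : ℕ} {S : Setup K M N} {X : Signals Ω K M N} (hX : X.HasModel P S) (k : Fin K) :
    FiniteMoments P X (satEstimate P S X) (apEstimate P S X) k ∧
    ∫ ω, overallCoeff X (satEstimate P S X) (apEstimate P S X) k k ω ∂P
      = ((‖S.gbar k‖ ^ 2 + S.p * K * (S.Θ k).trace.re + ∑ m, S.γ m k : ℝ) : ℂ) ∧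
    (∀ k' ≠ k, ∫ ω, overallCoeff X (satEstimate P S X) (apEstimate P S X) k k' ω ∂P
      = inner ℂ (S.gbar k) (S.gbar k')) ∧
    (∀ k', ∫ ω, ‖overallCoeff X (satEstimate P S X) (apEstimate P S X) k k' ω‖ ^ 2 ∂P
      = ‖∫ ω, overallCoeff X (satEstimate P S X) (apEstimate P S X) k k' ω ∂P‖ ^ 2
        + (S.p * K * quadForm (S.Θ k) (S.gbar k') + quadForm (S.R k') (S.gbar k)
          + S.p * K * (S.R k' * S.Θ k).trace.re + ∑ m, S.γ m k * S.β m k')) ∧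
    ∫ ω, ‖inner ℂ (satEstimate P S X k ω) (X.w ω)‖ ^ 2 ∂P
      = S.σs ^ 2 * (‖S.gbar k‖ ^ 2 + S.p * K * (S.Θ k).trace.re) ∧
    ∀ m, ∫ ω, ‖conj (apEstimate P S X m k ω) * X.wAP m ω‖ ^ 2 ∂P = S.σa ^ 2 * S.γ m k := by
  obtain ⟨f, hf, hsat, hall, hallw, hmean, hmeans, hsq, hnoise⟩ := exists_satEstimate_moments hX k
  choose fAP hfAP hap hallAP hallwAP hmeanAP hmeansAP hsqAP hnoiseAP using
    fun m => exists_apEstimate_moments hX m k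
  have hF : ∀ k' i, HasAllMoments P (coeffPart S X k f fAP k' i) := by
    intro k' i
    cases i with
    | none => exact hall k'
    | some m => exact hallAP m k'
  -- Conditional expectations are determined only almost everywhere, so the estimates are replaced
  -- by functions of the observations under the integral.
  have hz : ∀ k', overallCoeff X (satEstimate P S X) (apEstimate P S X) k k'
      =ᵐ[P] fun ω => ∑ i, coeffPart S X k f fAP k' i ω := by
    intro k'
    filter_upwards [hsat, ae_all_iff.2 hap] with ω h1 h2
    rw [Fintype.sum_option]
    simp only [overallCoeff, coeffPart, h1, h2]
  have hzall : ∀ k', HasAllMoments P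
      (overallCoeff X (satEstimate P S X) (apEstimate P S X) k k') := fun k' =>
    (HasAllMoments.sum Finset.univ fun i _ => hF k' i).congr_ae (hz k').symm
  have hw : (fun ω => inner ℂ (satEstimate P S X k ω) (X.w ω))
      =ᵐ[P] fun ω => inner ℂ (f (satObs S X k ω)) (X.w ω) := by
    filter_upwards [hsat] with ω h1
    rw [h1]
  have hwAP : ∀ m, (fun ω => conj (apEstimate P S X m k ω) * X.wAP m ω)
      =ᵐ[P] fun ω => conj (fAP m (apObs S X m k ω)) * X.wAP m ω := by
    intro m
    filter_upwards [hap m] with ω h1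
    rw [h1]
  have hEz : ∀ k', ∫ ω, overallCoeff X (satEstimate P S X) (apEstimate P S X) k k' ω ∂P
      = ∑ i, ∫ ω, coeffPart S X k f fAP k' i ω ∂P := by
    intro k'
    rw [integral_congr_ae (hz k'), integral_finsetSum _ fun i _ => (hF k' i).integrable]
  refine ⟨⟨(hzall k).integrable, fun k' => (hzall k').integrable_norm_sq,
    (hallw.congr_ae hw.symm).integrable_norm_sq,
    fun m => ((hallwAP m).congr_ae (hwAP m).symm).integrable_norm_sq⟩, ?_, fun k' hk' => ?_,
    fun k' => ?_, ?_, fun m => ?_⟩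
  · rw [hEz, Fintype.sum_option]
    simp only [coeffPart, hmean, hmeanAP]
    push_cast
    rfl
  · rw [hEz, Fintype.sum_option]
    simp only [coeffPart, hmeans k' hk', fun m => hmeansAP m k' hk', Finset.sum_const_zero,
      add_zero]
  -- Different receivers draw on disjoint sources, so the variances of their contributions add.
  · have hpair : Pairwise fun i j =>
        IndepFun (coeffPart S X k f fAP k' i) (coeffPart S X k f fAP k' j) P := fun i j hij =>
      hX.indepFun_of_disjoint (disjoint_partSources hij)
        (measurable_coeffPart S X k hf hfAP k' i) (measurable_coeffPart S X k hf hfAP k' j)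
    have h1 := integral_norm_sum_sq_of_pairwise_indepFun (hF k') hpair
    have h2 : ∫ ω, ‖overallCoeff X (satEstimate P S X) (apEstimate P S X) k k' ω‖ ^ 2 ∂P
        = ∫ ω, ‖∑ i, coeffPart S X k f fAP k' i ω‖ ^ 2 ∂P := by
      refine integral_congr_ae ?_
      filter_upwards [hz k'] with ω h
      rw [h]
    rw [h2, h1, ← hEz]
    congr 1
    rw [Fintype.sum_option]
    simp only [coeffPart, hsq, hsqAP, add_sub_cancel_left]
  · rw [← hnoise]
    refine integral_congr_ae ?_
    filter_upwards [hw] with ω h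
    rw [h]
  · rw [← hnoiseAP m]
    refine integral_congr_ae ?_
    filter_upwards [hwAP m] with ω h
    rw [h]

theorem sinr_eq_closedSINR {Ω : Type*} [MeasurableSpace Ω] {P : Measure Ω} [IsProbabilityMeasure P]
    {K M N : ℕ} {S : Setup K M N} {X : Signals Ω K M N} (hX : X.HasModel P S) (k : Fin K) :
    sinr P S X (satEstimate P S X) (apEstimate P S X) k = S.closedSINR k := by
  obtain ⟨-, hmean, hmeans, hsq, hnoise, hnoiseAP⟩ := mrc_moments hX k
  rw [sinr, Setup.closedSINR]
  have hnum : ‖∫ ω, overallCoeff X (satEstimate P S X) (apEstimate P S X) k k ω ∂P‖ ^ 2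
      = (‖S.gbar k‖ ^ 2 + S.p * K * (S.Θ k).trace.re + ∑ m, S.γ m k) ^ 2 := by
    rw [hmean, Complex.norm_real, Real.norm_eq_abs, sq_abs]
  have hcross : ∑ k' ∈ Finset.univ.erase k, S.ρ k'
        * ‖∫ ω, overallCoeff X (satEstimate P S X) (apEstimate P S X) k k' ω ∂P‖ ^ 2
      = ∑ k' ∈ Finset.univ.erase k, S.ρ k' * ‖inner ℂ (S.gbar k) (S.gbar k')‖ ^ 2 :=
    Finset.sum_congr rfl fun k' hk' => by rw [hmeans k' (Finset.ne_of_mem_erase hk')]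
  -- Numerators and denominators agree separately, so a vanishing denominator needs no separate
  -- case.
  congr 1
  · rw [hnum]
  · simp only [hsq, hnoise, hnoiseAP]
    simp only [mul_add (S.ρ _), Finset.sum_add_distrib]
    -- The squared mean for `k' = k` is split off to cancel the subtracted term; the others form the
    -- first sum of `MI`.
    rw [← Finset.sum_erase_add _ _ (Finset.mem_univ k), hcross, Setup.MI, Setup.NO]
    have e1 : ∀ F : Fin K → ℝ, ∑ k', S.ρ k' * (S.p * K * F k') = S.p * K * ∑ k', S.ρ k' * F k' := by
      intro F
      rw [Finset.mul_sum]
      exact Finset.sum_congr rfl fun _ _ => by ring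
    have e2 : ∑ k', S.ρ k' * ∑ m, S.γ m k * S.β m k' = ∑ k', ∑ m, S.ρ k' * S.γ m k * S.β m k' := by
      refine Finset.sum_congr rfl fun k' _ => ?_
      rw [Finset.mul_sum]
      exact Finset.sum_congr rfl fun _ _ => by ring
    rw [e1, e1, e2, ← Finset.mul_sum]
    ring

end SpaceTerrestrial

theorem theorem1 {Ω : Type*} [MeasurableSpace Ω] (P : Measure Ω) [IsProbabilityMeasure P]
    {K M N : ℕ} (S : SpaceTerrestrial.Setup K M N) (X : SpaceTerrestrial.Signals Ω K M N)
    (hX : X.HasModel P S) (k : Fin K) :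
    SpaceTerrestrial.FiniteMoments P X
      (SpaceTerrestrial.satEstimate P S X) (SpaceTerrestrial.apEstimate P S X) k ∧
    SpaceTerrestrial.sinr P S X
      (SpaceTerrestrial.satEstimate P S X) (SpaceTerrestrial.apEstimate P S X) k
        = S.closedSINR k ∧
    ∀ (τc : ℕ) (B : ℝ), K < τc → 0 < B →
      SpaceTerrestrial.throughput K τc B
        (SpaceTerrestrial.sinr P S X
          (SpaceTerrestrial.satEstimate P S X) (SpaceTerrestrial.apEstimate P S X) k)
        = SpaceTerrestrial.throughput K τc B (S.closedSINR k) := by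
  have h := SpaceTerrestrial.sinr_eq_closedSINR hX k
  exact ⟨(SpaceTerrestrial.mrc_moments hX k).1, h, fun τc B _ _ => by rw [h]⟩
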